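/- For a finite graph $G=(V,E)$ (loops and parallel edges allowed), let $T(G;x,y)=\sum_{A\subseteq E}(x-1)^{k(A)-k(E)}(y-1)^{k(A)+|A|-|V|}$ be its Tutte polynomial, where $k(A)$ is the number of connected components of $(V,A)$. For $q\in\mathbb{Z}$ let $H_q=\{(a,b)\in\mathbb{C}^2:(a-1)(b-1)=q\}$. **Theorem.** Let $q\ge 3$ be an integer. There is an algorithm that, given a point $(a,b)\in H_q$, a graph $G$ with $n$ vertices and $m$ edges, and a tree decomposition of $G$ of width $\mathrm{tw}$ whose tree has $N$ nodes, computes $T(G;a,b)$ in time $q^{\mathrm{tw}}\cdot(n+m+N)^{O(1)}$. (In particular, the time is $q^{\mathrm{tw}}n^{O(1)}$ for simple graphs $G$ and decompositions with $N=n^{O(1)}$ nodes.) Explicitly: there are a program and constants $C,c$, all depending on $q$ only, such that on every such input the program halts with the value $T(G;a,b)$ within $C\,q^{\mathrm{tw}}(n+m+N)^{c}$ steps. The model of computation is a word RAM with an additional type of cells for complex numbers: arithmetic, comparison and indirect addressing on words take one step each, as do the four field operations, the test for zero, the conversion of a word to a number, and reading and writing for complex numbers; the words occurring in a run never exceed the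 above time bound (so that words have $O(\mathrm{tw}\cdot\log q+\log(n+m+N))$ bits). The width of a tree decomposition is the maximum bag size minus one (taken to be $0$ for the graph without vertices). -/

import Mathlib

/-! ## Graphs and the Tutte polynomial -/

/-- A finite graph with vertices `0, …, n - 1` and edges `0, …, m - 1`; loops and parallel edges are
allowed. `ends e` is the pair of endpoints of `e`, listed in an arbitrary order. -/
structure Multigraph (n m : ℕ) where
  ends : Fin m → Fin n × Fin n

namespace Multigraph

variable {n m : ℕ}

/-- The adjacency of the graph `(V, A)`: distinct vertices joined by an edge of `A`. -/
def spanning (G : Multigraph n m) (A : Finset (Fin m)) : SimpleGraph (Fin n) :=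
  SimpleGraph.fromRel fun u v => ∃ e ∈ A, G.ends e = (u, v)

/-- `k(A)`, the number of connected components of the graph `(V, A)`. -/
noncomputable def numComponents (G : Multigraph n m) (A : Finset (Fin m)) : ℕ :=
  Nat.card (G.spanning A).ConnectedComponent

/-- `T(G; x, y) = ∑_{A ⊆ E} (x - 1)^(k(A) - k(E)) (y - 1)^(k(A) + |A| - |V|)`. The exponents are
computed in `ℤ`; they are never negative. -/
noncomputable def tutte (G : Multigraph n m) (x y : ℂ) : ℂ :=
  ∑ A : Finset (Fin m),
    (x - 1) ^ ((G.numComponents A : ℤ) - (G.numComponents Finset.univ : ℤ)) *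
      (y - 1) ^ ((G.numComponents A : ℤ) + (A.card : ℤ) - (n : ℤ))

end Multigraph

/-- The hyperbola `H_α`. -/
def hyperbola (α : ℂ) : Set (ℂ × ℂ) := {z | (z.1 - 1) * (z.2 - 1) = α}

/-- A tree decomposition of `G` whose tree has the nodes `0, …, N - 1`. -/
structure TreeDecomposition {n m : ℕ} (G : Multigraph n m) (N : ℕ) where
  tree : SimpleGraph (Fin N)
  isTree : tree.IsTree
  bag : Fin N → Finset (Fin n)
  vertex_covered : ∀ v, ∃ x, v ∈ bag x
  edge_covered : ∀ e, ∃ x, (G.ends e).1 ∈ bag x ∧ (G.ends e).2 ∈ bag x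
  subtree : ∀ v, (tree.induce {x | v ∈ bag x}).Connected

/-- `max_x |B_x| - 1`. The subtraction truncates only for the graph without vertices. -/
def TreeDecomposition.width {n m N : ℕ} {G : Multigraph n m} (D : TreeDecomposition G N) : ℕ :=
  (Finset.univ.sup fun x => (D.bag x).card) - 1

/-! ## The machine: a word RAM with unit-cost arithmetic on complex numbers -/

namespace RAM

/-- A memory configuration. Words and numbers are kept apart. Both kinds have registers, and arrays
that are addressed by words: `warr r i` and `narr r i` are the `i`-th entries of the array `r`.
A program names its registers and arrays explicitly, so it uses a fixed finite number of them. -/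
structure State where
  wreg : ℕ → ℕ
  warr : ℕ → ℕ → ℕ
  nreg : ℕ → ℂ
  narr : ℕ → ℕ → ℂ

/-- Arithmetic on words: truncated subtraction, quotient and remainder of integer division. -/
inductive WordOp
  | add | sub | mul | div | mod

def WordOp.eval : WordOp → ℕ → ℕ → ℕ
  | add, u, v => u + v
  | sub, u, v => u - v
  | mul, u, v => u * v
  | div, u, v => u / v
  | mod, u, v => u % v

/-- Arithmetic on complex numbers. -/
inductive NumOp
  | add | sub | mul | div

noncomputable def NumOp.eval : NumOp → ℂ → ℂ → ℂ
  | add, u, v => u + v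
  | sub, u, v => u - v
  | mul, u, v => u * v
  | div, u, v => u / v

/-- The instructions; each of them takes one step. -/
inductive Instr
  /-- `wreg i := k` -/
  | wconst (i k : ℕ)
  /-- `wreg i := wreg j ∘ wreg k` -/
  | wop (o : WordOp) (i j k : ℕ)
  /-- `wreg i := warr r (wreg j)` -/
  | wload (i r j : ℕ)
  /-- `warr r (wreg j) := wreg i` -/
  | wstore (r j i : ℕ)
  /-- `nreg i := wreg j`, read as a complex number -/
  | ncast (i j : ℕ)
  /-- `nreg i := nreg j ∘ nreg k` -/
  | nop (o : NumOp) (i j k : ℕ)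
  /-- `nreg i := narr r (wreg j)` -/
  | nload (i r j : ℕ)
  /-- `narr r (wreg j) := nreg i` -/
  | nstore (r j i : ℕ)

def State.setWReg (s : State) (i v : ℕ) : State :=
  { s with wreg := Function.update s.wreg i v }

def State.setWArr (s : State) (r j v : ℕ) : State :=
  { s with warr := Function.update s.warr r (Function.update (s.warr r) j v) }

noncomputable def State.setNReg (s : State) (i : ℕ) (z : ℂ) : State :=
  { s with nreg := Function.update s.nreg i z }

noncomputable def State.setNArr (s : State) (r j : ℕ) (z : ℂ) : State :=
  { s with narr := Function.update s.narr r (Function.update (s.narr r) j z) }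

noncomputable def Instr.exec : Instr → State → State
  | wconst i k, s => s.setWReg i k
  | wop o i j k, s => s.setWReg i (o.eval (s.wreg j) (s.wreg k))
  | wload i r j, s => s.setWReg i (s.warr r (s.wreg j))
  | wstore r j i, s => s.setWArr r (s.wreg j) (s.wreg i)
  | ncast i j, s => s.setNReg i (s.wreg j : ℂ)
  | nop o i j k, s => s.setNReg i (o.eval (s.nreg j) (s.nreg k))
  | nload i r j, s => s.setNReg i (s.narr r (s.wreg j))
  | nstore r j i, s => s.setNArr r (s.wreg j) (s.nreg i)

/-- The tests; each of them takes one step. -/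
inductive Test
  | wlt (i j : ℕ)
  | weq (i j : ℕ)
  | nzero (i : ℕ)

def Test.holds : Test → State → Prop
  | wlt i j, s => s.wreg i < s.wreg j
  | weq i j, s => s.wreg i = s.wreg j
  | nzero i, s => s.nreg i = 0

inductive Program
  | skip
  | instr (c : Instr)
  | seq (p₁ p₂ : Program)
  | ite (b : Test) (p₁ p₂ : Program)
  | loop (b : Test) (p : Program)

/-- All words of the configuration are less than `W`, that is, they fit into words with `W` possible
values. -/
def State.WordsBelow (s : State) (W : ℕ) : Prop :=
  (∀ i, s.wreg i < W) ∧ ∀ r i, s.warr r i < W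

/-- `Exec W p s t s'`: started in `s`, the program `p` halts in `s'` after exactly `t` steps, and all
words in all configurations that it produces on the way are less than `W` (no overflow occurs).
`loop b p` repeats `p` while `b` holds. -/
inductive Exec (W : ℕ) : Program → State → ℕ → State → Prop
  | skip (s : State) : Exec W .skip s 1 s
  | instr (c : Instr) (s : State) (h : (c.exec s).WordsBelow W) :
      Exec W (.instr c) s 1 (c.exec s)
  | seq {p₁ p₂ : Program} {s s₁ s₂ : State} {t₁ t₂ : ℕ}
      (h₁ : Exec W p₁ s t₁ s₁) (h₂ : Exec W p₂ s₁ t₂ s₂) :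
      Exec W (.seq p₁ p₂) s (t₁ + t₂) s₂
  | ite_true {b : Test} {p₁ p₂ : Program} {s s' : State} {t : ℕ}
      (hb : b.holds s) (h : Exec W p₁ s t s') : Exec W (.ite b p₁ p₂) s (t + 1) s'
  | ite_false {b : Test} {p₁ p₂ : Program} {s s' : State} {t : ℕ}
      (hb : ¬ b.holds s) (h : Exec W p₂ s t s') : Exec W (.ite b p₁ p₂) s (t + 1) s'
  | loop_false {b : Test} {p : Program} {s : State} (hb : ¬ b.holds s) :
      Exec W (.loop b p) s 1 s
  | loop_true {b : Test} {p : Program} {s s₁ s₂ : State} {t₁ t₂ : ℕ}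
      (hb : b.holds s) (h₁ : Exec W p s t₁ s₁) (h₂ : Exec W (.loop b p) s₁ t₂ s₂) :
      Exec W (.loop b p) s (t₁ + t₂ + 1) s₂

open Classical in
/-- The initial configuration on input `(G, D, a, b)`. The word registers `0, 1, 2` hold the numbers of
vertices, edges and tree nodes. The word arrays `0` and `1` hold the first and second endpoints of the
edges, array `2` the adjacency matrix of the tree and array `3` the node-vertex incidence matrix of the
bags, both row by row. The number registers `0, 1` hold `a, b`. All other entries are `0`. -/
noncomputable def input {n m N : ℕ} (G : Multigraph n m) (D : TreeDecomposition G N) (a b : ℂ) :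
    State where
  wreg
    | 0 => n
    | 1 => m
    | 2 => N
    | _ => 0
  warr
    | 0 => fun i => if h : i < m then ((G.ends ⟨i, h⟩).1 : ℕ) else 0
    | 1 => fun i => if h : i < m then ((G.ends ⟨i, h⟩).2 : ℕ) else 0
    | 2 => fun i => if ∃ x y : Fin N, i = x * N + y ∧ D.tree.Adj x y then 1 else 0
    | 3 => fun i => if ∃ (x : Fin N) (v : Fin n), i = x * n + v ∧ v ∈ D.bag x then 1 else 0
    | _ => fun _ => 0
  nreg
    | 0 => a
    | 1 => b
    | _ => 0
  narr := fun _ _ => 0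

/-- On the given input, `p` writes `T(G; a, b)` into the number register `0` and halts, within `B`
steps and with words that take at most `B` values. -/
def ComputesTutteWithin (p : Program) {n m N : ℕ} (G : Multigraph n m) (D : TreeDecomposition G N)
    (a b : ℂ) (B : ℕ) : Prop :=
  ∃ (t : ℕ) (s : State), Exec B p (input G D a b) t s ∧ t ≤ B ∧ s.nreg 0 = G.tutte a b

end RAM

/-! On `H_q` the Tutte polynomial is a Potts partition function in disguise. Let Z(x, y) be the sum
over all colorings of V with q colors of the product of a weight x for every monochromatic edge and
y for every other edge. Writing b = 1 + (b - 1) and expanding over edge sets gives Z(b, 1) = ∑_A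
q^k(A) (b - 1)^|A|, because q^k(A) colorings are constant along the edges of A. Substituting q = (a
- 1)(b - 1) turns this into T(G; a, b) = Z(b, 1) / ((b - 1)^n (a - 1)^k(E)); both denominators are
nonzero because q ≠ 0 (`tutte_mul`). The same count gives Z(1, 0) = q^k(E), so a second run of the
Potts computation supplies k(E) and no search for components is needed.

Z is computed by eliminating the nodes of the tree. Every node x has a table indexed by the
colorings of its bag B_x, initially constant 1. The weight of each edge is multiplied into the table
of one node whose bag contains both ends, so the product of all tables is the product of all edge
weights. Now let x be a leaf with neighbor y. A vertex that lies in B_x and in another remaining bag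
also lies in B_y. Hence the vertices of B_x \ B_y can be summed out of the table of x, and the
result, a function of the colors on B_x ∩ B_y, is multiplied into the table of y. This preserves the
sum over colorings of the product of the tables (`sum_eliminate`, `Pruned.total_erase`), and once a
single node is left, that sum is the sum of its table.

Sorting the entries of x into buckets by their code on B_x ∩ B_y lets a removal make a constant
number of passes over the two tables instead of running over pairs of colorings. The exponential
factor is thus q^(tw + 1), and the surplus q goes into the constant.

On the machine side, `Tr` is a Hoare triple with a time bound, `Exec.frame` preserves whatever a
program does not write, and colorings of bags are addressed by base-q numbers. -/

namespace RAM

/-! ## A program logic for the machine -/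

/-- The instruction may change the word register `i`. -/
def Instr.writesW : Instr → ℕ → Bool
  | wconst i _, r => r == i
  | wop _ i _ _, r => r == i
  | wload i _ _, r => r == i
  | _, _ => false

/-- The instruction may change the word array `r`. -/
def Instr.writesWA : Instr → ℕ → Bool
  | wstore a _ _, r => r == a
  | _, _ => false

/-- The instruction may change the number register `i`. -/
def Instr.writesN : Instr → ℕ → Bool
  | ncast i _, r => r == i
  | nop _ i _ _, r => r == i
  | nload i _ _, r => r == i
  | _, _ => false

/-- The instruction may change the number array `r`. -/
def Instr.writesNA : Instr → ℕ → Bool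
  | nstore a _ _, r => r == a
  | _, _ => false

/-- Some instruction of the program satisfies `f`. -/
def Program.any (f : Instr → Bool) : Program → Bool
  | skip => false
  | instr c => f c
  | seq p₁ p₂ => p₁.any f || p₂.any f
  | ite _ p₁ p₂ => p₁.any f || p₂.any f
  | loop _ p => p.any f

def Program.writesW (p : Program) (i : ℕ) : Bool := p.any (·.writesW i)
def Program.writesWA (p : Program) (r : ℕ) : Bool := p.any (·.writesWA r)
def Program.writesN (p : Program) (i : ℕ) : Bool := p.any (·.writesN i)
def Program.writesNA (p : Program) (r : ℕ) : Bool := p.any (·.writesNA r)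

/-- What `p` never writes has the same value in `s` and `s'`. -/
structure Frame (p : Program) (s s' : State) : Prop where
  w : ∀ i, p.writesW i = false → s'.wreg i = s.wreg i
  wa : ∀ r, p.writesWA r = false → s'.warr r = s.warr r
  n : ∀ i, p.writesN i = false → s'.nreg i = s.nreg i
  na : ∀ r, p.writesNA r = false → s'.narr r = s.narr r

theorem Frame.refl (p : Program) (s : State) : Frame p s s :=
  ⟨fun _ _ => rfl, fun _ _ => rfl, fun _ _ => rfl, fun _ _ => rfl⟩

theorem Frame.trans {p : Program} {s s₁ s₂ : State} (h₁ : Frame p s s₁) (h₂ : Frame p s₁ s₂) :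
    Frame p s s₂ :=
  ⟨fun i h => (h₂.w i h).trans (h₁.w i h), fun i h => (h₂.wa i h).trans (h₁.wa i h),
    fun i h => (h₂.n i h).trans (h₁.n i h), fun i h => (h₂.na i h).trans (h₁.na i h)⟩

theorem Frame.mono {p p' : Program} {s s' : State} (h : Frame p s s')
    (hp : ∀ f, p'.any f = false → p.any f = false) : Frame p' s s' :=
  ⟨fun _ hi => h.w _ (hp _ hi), fun _ hi => h.wa _ (hp _ hi), fun _ hi => h.n _ (hp _ hi),
    fun _ hi => h.na _ (hp _ hi)⟩

@[simp] theorem State.setWReg_wreg (s : State) (i v j : ℕ) :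
    (s.setWReg i v).wreg j = if j = i then v else s.wreg j := by
  simp [State.setWReg, Function.update_apply]

@[simp] theorem State.setWReg_warr (s : State) (i v : ℕ) : (s.setWReg i v).warr = s.warr := rfl
@[simp] theorem State.setWReg_nreg (s : State) (i v : ℕ) : (s.setWReg i v).nreg = s.nreg := rfl
@[simp] theorem State.setWReg_narr (s : State) (i v : ℕ) : (s.setWReg i v).narr = s.narr := rfl

@[simp] theorem State.setWArr_warr (s : State) (r j v r' j' : ℕ) :
    (s.setWArr r j v).warr r' j' = if r' = r ∧ j' = j then v else s.warr r' j' := by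
  by_cases h : r' = r
  · subst h; simp [State.setWArr, Function.update_apply]
  · simp [State.setWArr, h]

@[simp] theorem State.setWArr_wreg (s : State) (r j v : ℕ) : (s.setWArr r j v).wreg = s.wreg := rfl
@[simp] theorem State.setWArr_nreg (s : State) (r j v : ℕ) : (s.setWArr r j v).nreg = s.nreg := rfl
@[simp] theorem State.setWArr_narr (s : State) (r j v : ℕ) : (s.setWArr r j v).narr = s.narr := rfl

@[simp] theorem State.setNReg_nreg (s : State) (i : ℕ) (z : ℂ) (j : ℕ) :
    (s.setNReg i z).nreg j = if j = i then z else s.nreg j := by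
  simp [State.setNReg, Function.update_apply]

@[simp] theorem State.setNReg_wreg (s : State) (i : ℕ) (z : ℂ) : (s.setNReg i z).wreg = s.wreg := rfl
@[simp] theorem State.setNReg_warr (s : State) (i : ℕ) (z : ℂ) : (s.setNReg i z).warr = s.warr := rfl
@[simp] theorem State.setNReg_narr (s : State) (i : ℕ) (z : ℂ) : (s.setNReg i z).narr = s.narr := rfl

@[simp] theorem State.setNArr_narr (s : State) (r j : ℕ) (z : ℂ) (r' j' : ℕ) :
    (s.setNArr r j z).narr r' j' = if r' = r ∧ j' = j then z else s.narr r' j' := by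
  by_cases h : r' = r
  · subst h; simp [State.setNArr, Function.update_apply]
  · simp [State.setNArr, h]

@[simp] theorem State.setNArr_wreg (s : State) (r j : ℕ) (z : ℂ) :
    (s.setNArr r j z).wreg = s.wreg := rfl
@[simp] theorem State.setNArr_warr (s : State) (r j : ℕ) (z : ℂ) :
    (s.setNArr r j z).warr = s.warr := rfl
@[simp] theorem State.setNArr_nreg (s : State) (r j : ℕ) (z : ℂ) :
    (s.setNArr r j z).nreg = s.nreg := rfl

theorem Instr.frame (c : Instr) (s : State) : Frame (.instr c) s (c.exec s) := by
  constructor <;> intro i h <;> cases c <;>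
    simp_all [Program.writesW, Program.writesWA, Program.writesN, Program.writesNA, Program.any,
      Instr.writesW, Instr.writesWA, Instr.writesN, Instr.writesNA, Instr.exec, funext_iff]

/-- What a program may write is a computable property of its text, so for concrete programs it is
settled by `rfl` or `decide`. Postconditions therefore need to mention only what changes; the rest
is recovered from the frame. -/
theorem Exec.frame {W : ℕ} {p : Program} {s s' : State} {t : ℕ} (h : Exec W p s t s') :
    Frame p s s' := by
  induction h with
  | skip s => exact Frame.refl _ _
  | instr c s h => exact c.frame s
  | seq _ _ h₁ h₂ =>
    exact (h₁.mono (by simp +contextual [Program.any])).trans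
      (h₂.mono (by simp +contextual [Program.any]))
  | ite_true _ _ h => exact h.mono (by simp +contextual [Program.any])
  | ite_false _ _ h => exact h.mono (by simp +contextual [Program.any])
  | loop_false _ => exact Frame.refl _ _
  | loop_true _ _ _ h₁ h₂ => exact (h₁.mono (by simp +contextual [Program.any])).trans h₂

/-- `p`, started in `s`, halts within `T` steps, with all words below `W`, in a state satisfying
`Q`. -/
def Tr (W : ℕ) (p : Program) (T : ℕ) (s : State) (Q : State → Prop) : Prop :=
  s.WordsBelow W → ∃ t s', Exec W p s t s' ∧ t ≤ T ∧ s'.WordsBelow W ∧ Q s'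

variable {W : ℕ} {p p₁ p₂ : Program} {T T₁ T₂ : ℕ} {s : State} {Q R : State → Prop}

theorem Tr.mono (h : Tr W p T₁ s R) (hT : T₁ ≤ T) (hQ : ∀ s', Frame p s s' → R s' → Q s') :
    Tr W p T s Q := by
  intro hs
  obtain ⟨t, s', he, ht, hw, hr⟩ := h hs
  exact ⟨t, s', he, ht.trans hT, hw, hQ s' he.frame hr⟩

theorem Tr.skip (h : Q s) : Tr W .skip 1 s Q := fun hs => ⟨1, s, .skip s, le_rfl, hs, h⟩

theorem Tr.seq (h₁ : Tr W p₁ T₁ s R) (h₂ : ∀ s₁, Frame p₁ s s₁ → R s₁ → Tr W p₂ T₂ s₁ Q) :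
    Tr W (.seq p₁ p₂) (T₁ + T₂) s Q := by
  intro hs
  obtain ⟨t₁, s₁, he₁, ht₁, hw₁, hr⟩ := h₁ hs
  obtain ⟨t₂, s₂, he₂, ht₂, hw₂, hq⟩ := h₂ s₁ he₁.frame hr hw₁
  exact ⟨_, s₂, .seq he₁ he₂, by omega, hw₂, hq⟩

theorem Tr.ite {b : Test} (h₁ : b.holds s → Tr W p₁ T s Q) (h₂ : ¬ b.holds s → Tr W p₂ T s Q) :
    Tr W (.ite b p₁ p₂) (T + 1) s Q := by
  intro hs
  by_cases hb : b.holds s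
  · obtain ⟨t, s', he, ht, hw, hq⟩ := h₁ hb hs
    exact ⟨_, s', .ite_true hb he, by omega, hw, hq⟩
  · obtain ⟨t, s', he, ht, hw, hq⟩ := h₂ hb hs
    exact ⟨_, s', .ite_false hb he, by omega, hw, hq⟩

/-- The word that `c` produces, if any, is less than `W`. -/
def Instr.Safe (W : ℕ) : Instr → State → Prop
  | wconst _ k, _ => k < W
  | wop o _ j k, s => o.eval (s.wreg j) (s.wreg k) < W
  | _, _ => True

/-- Loads and stores only copy words that are already present; only constants and word arithmetic
can overflow. -/
theorem State.WordsBelow.exec {c : Instr} (hs : s.WordsBelow W) (h : c.Safe W s) :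
    (c.exec s).WordsBelow W := by
  obtain ⟨h₁, h₂⟩ := hs
  cases c <;> refine ⟨fun i => ?_, fun r i => ?_⟩ <;> simp only [Instr.exec, State.setWReg_wreg,
    State.setWReg_warr, State.setWArr_wreg, State.setWArr_warr, State.setNReg_wreg,
    State.setNReg_warr, State.setNArr_wreg, State.setNArr_warr] <;>
    first
    | exact h₁ _
    | exact h₂ _ _
    | (split_ifs
       · first | exact h | exact h₁ _ | exact h₂ _ _
       · first | exact h₁ _ | exact h₂ _ _)

/-- A sequence of instructions. -/
def block : List Instr → Program
  | [] => .skip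
  | c :: l => .seq (.instr c) (block l)

noncomputable def execs : List Instr → State → State
  | [], s => s
  | c :: l, s => execs l (c.exec s)

def Safes (W : ℕ) : List Instr → State → Prop
  | [], _ => True
  | c :: l, s => c.Safe W s ∧ Safes W l (c.exec s)

/-- Straight-line code is verified by symbolic execution, with `simp` unfolding `Safes` and `execs`.
The additional step pays for the final `skip`. -/
theorem Tr.block {l : List Instr} (h : Safes W l s) (hQ : Q (execs l s)) :
    Tr W (block l) (l.length + 1) s Q := by
  induction l generalizing s with
  | nil => exact Tr.skip hQ
  | cons c l ih =>
    intro hs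
    have hw := hs.exec h.1
    obtain ⟨t, s', he, ht, hw', hq⟩ := ih h.2 hQ hw
    exact ⟨_, s', .seq (.instr c s hw) he, by simp only [List.length_cons]; omega, hw', hq⟩

/-- `for i < b do p`; the word register `3` has to hold `1`. -/
def forLoop (i b : ℕ) (p : Program) : Program :=
  .seq (.instr (.wconst i 0)) (.loop (.wlt i b) (.seq p (.instr (.wop .add i i 3))))

theorem forLoop_any (f : Instr → Bool) (i b : ℕ) (p : Program) :
    (forLoop i b p).any f = (f (.wconst i 0) || (p.any f || f (.wop .add i i 3))) := rfl

theorem forLoop_writesW (i b : ℕ) (p : Program) (r : ℕ) :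
    (forLoop i b p).writesW r = (r == i || p.writesW r) := by
  simp only [Program.writesW, forLoop_any, Instr.writesW]
  cases (r == i) <;> simp

/-- `I j` holds before round `j`, so the body has to establish `I (j + 1)` for the state in which
the counter is already increased. A round costs the body, the increment and the test; the last 2
steps are the initialization and the failing test. The counter cannot overflow, since it never
exceeds the bound, which is itself a stored word. -/
theorem Tr.forLoop {i b k : ℕ} (I : ℕ → State → Prop) (hb : s.wreg b = k) (h1 : s.wreg 3 = 1)
    (hib : i ≠ b) (hi3 : i ≠ 3)
    (hp : p.writesW i = false ∧ p.writesW b = false ∧ p.writesW 3 = false)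
    (h₀ : I 0 (s.setWReg i 0))
    (hstep : ∀ j < k, ∀ s', Frame (forLoop i b p) s s' → s'.wreg i = j → I j s' →
      Tr W p T s' fun s'' => I (j + 1) (s''.setWReg i (j + 1)))
    (hQ : ∀ s', Frame (RAM.forLoop i b p) s s' → I k s' → Q s') :
    Tr W (forLoop i b p) (k * (T + 2) + 2) s Q := by
  intro hs
  have hkW : k < W := hb ▸ hs.1 b
  obtain ⟨hpi, hpb, hp3⟩ := hp
  have hwb : (RAM.forLoop i b p).writesW b = false := by
    rw [forLoop_writesW, hpb]; simp [hib.symm]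
  have hw3 : (RAM.forLoop i b p).writesW 3 = false := by
    rw [forLoop_writesW, hp3]; simp [hi3.symm]
  have hs₀ : (Instr.exec (.wconst i 0) s).WordsBelow W := hs.exec (by simp [Instr.Safe]; omega)
  have key : ∀ d j, j + d = k → ∀ s', s'.WordsBelow W → Frame (RAM.forLoop i b p) s s' →
      s'.wreg i = j → I j s' →
      ∃ t s'', Exec W (.loop (.wlt i b) (.seq p (.instr (.wop .add i i 3)))) s' t s'' ∧
        t ≤ d * (T + 2) + 1 ∧ s''.WordsBelow W ∧ I k s'' := by
    intro d
    induction d with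
    | zero =>
      intro j hj s' hw hf hij hI
      refine ⟨1, s', .loop_false ?_, by simp, hw, ?_⟩
      · simp only [Test.holds, hij, hf.w b hwb, hb]; omega
      · obtain rfl : j = k := by omega
        exact hI
    | succ d ih =>
      intro j hj s' hw hf hij hI
      have hjk : j < k := by omega
      obtain ⟨t₁, s₁, he₁, ht₁, hw₁, hq₁⟩ := hstep j hjk s' hf hij hI hw
      have hf₁ := he₁.frame
      have e : Instr.exec (.wop .add i i 3) s₁ = s₁.setWReg i (j + 1) := by
        simp only [Instr.exec, WordOp.eval, hf₁.w i hpi, hij, hf₁.w 3 hp3, hf.w 3 hw3, h1]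
      have hw₂ : (s₁.setWReg i (j + 1)).WordsBelow W := by
        rw [← e]
        refine hw₁.exec ?_
        simp only [Instr.Safe, WordOp.eval, hf₁.w i hpi, hij, hf₁.w 3 hp3, hf.w 3 hw3, h1]
        omega
      have he₂ : Exec W (.instr (.wop .add i i 3)) s₁ 1 (s₁.setWReg i (j + 1)) := by
        rw [← e]; exact .instr _ _ (by rw [e]; exact hw₂)
      have hf₂ : Frame (RAM.forLoop i b p) s (s₁.setWReg i (j + 1)) := by
        refine hf.trans (Frame.mono (Exec.seq he₁ he₂).frame ?_)
        intro f hf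
        simp only [forLoop_any, Bool.or_eq_false_iff] at hf
        simp [Program.any, hf]
      obtain ⟨t₂, s₂, he₃, ht₂, hw₃, hq⟩ := ih (j + 1) (by omega) _ hw₂ hf₂ (by simp) hq₁
      refine ⟨_, s₂, .loop_true ?_ (.seq he₁ he₂) he₃, ?_, hw₃, hq⟩
      · simp only [Test.holds, hij, hf.w b hwb, hb]; omega
      · rw [Nat.succ_mul]; omega
  have hinit : Exec W (.instr (.wconst i 0)) s 1 (s.setWReg i 0) := .instr _ _ hs₀
  obtain ⟨t, s', he, ht, hw, hq⟩ := key k 0 (by omega) (s.setWReg i 0) hs₀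
    (hinit.frame.mono fun f hf => by simp only [forLoop_any, Bool.or_eq_false_iff] at hf; exact hf.1)
    (by simp) h₀
  have hE : Exec W (RAM.forLoop i b p) s (1 + t) s' := .seq hinit he
  exact ⟨_, s', hE, by omega, hw, hQ s' hE.frame hq⟩

end RAM

/-! ## Colorings of sets of vertices and their codes -/

namespace Coloring

variable {n q : ℕ}

/-- The colors of the vertices in `B`, read as a number in base `q`. -/
def code (B : Finset (Fin n)) (σ : Fin n → Fin q) : ℕ :=
  ∑ v ∈ B, (σ v : ℕ) * q ^ (B.filter (· < v)).card

/-- The vertices in `B` less than `k`. -/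
def below (B : Finset (Fin n)) (k : ℕ) : Finset (Fin n) := B.filter fun v => (v : ℕ) < k

theorem below_zero (B : Finset (Fin n)) : below B 0 = ∅ := by simp [below]

theorem below_self (B : Finset (Fin n)) : below B n = B := by simp [below]

theorem below_succ_of_mem {B : Finset (Fin n)} {v : Fin n} (h : v ∈ B) :
    below B (v + 1) = insert v (below B v) := by
  ext u
  simp only [below, Finset.mem_filter, Finset.mem_insert, Fin.ext_iff]
  constructor
  · rintro ⟨hu, h'⟩
    by_cases e : (u : ℕ) = v
    · exact .inl e
    · exact .inr ⟨hu, by omega⟩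
  · rintro (e | ⟨hu, h'⟩)
    · obtain rfl : u = v := Fin.ext e
      exact ⟨h, by omega⟩
    · exact ⟨hu, by omega⟩

theorem below_succ_of_notMem {B : Finset (Fin n)} {v : Fin n} (h : v ∉ B) :
    below B (v + 1) = below B v := by
  ext u
  simp only [below, Finset.mem_filter]
  refine and_congr_right fun hu => ?_
  have : (u : ℕ) ≠ v := fun e => h (Fin.ext e ▸ hu)
  omega

theorem lt_of_mem_below {B : Finset (Fin n)} {v : Fin n} : ∀ u ∈ below B v, u < v := by
  intro u hu
  simpa [below] using (Finset.mem_filter.1 hu).2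

theorem card_below_succ_of_mem {B : Finset (Fin n)} {v : Fin n} (h : v ∈ B) :
    (below B (v + 1)).card = (below B v).card + 1 := by
  rw [below_succ_of_mem h, Finset.card_insert_of_notMem]
  exact fun h' => (lt_of_mem_below v h').false

theorem card_below_le (B : Finset (Fin n)) (k : ℕ) : (below B k).card ≤ B.card :=
  Finset.card_le_card (Finset.filter_subset _ _)

theorem code_empty (σ : Fin n → Fin q) : code ∅ σ = 0 := by simp [code]

theorem code_congr {B : Finset (Fin n)} {σ τ : Fin n → Fin q} (h : ∀ v ∈ B, σ v = τ v) :
    code B σ = code B τ :=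
  Finset.sum_congr rfl fun v hv => by rw [h v hv]

theorem code_insert {A : Finset (Fin n)} {v : Fin n} (h : ∀ u ∈ A, u < v) (σ : Fin n → Fin q) :
    code (insert v A) σ = code A σ + σ v * q ^ A.card := by
  have hv : v ∉ A := fun h' => (h v h').false
  rw [code, Finset.sum_insert hv, add_comm, code]
  congr 1
  · refine Finset.sum_congr rfl fun u hu => ?_
    rw [Finset.filter_insert, if_neg (not_lt.2 (h u hu).le)]
  · rw [Finset.filter_insert, if_neg (lt_irrefl v), Finset.filter_true_of_mem h]

/-- Induction on the maximum peels off the leading digit, which belongs to the largest vertex.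
Together with `eq_of_code_eq` and `exists_code_eq` this makes `code B` a bijection from `cols q B`
onto the numbers below `q ^ B.card`. -/
theorem code_lt (B : Finset (Fin n)) (σ : Fin n → Fin q) : code B σ < q ^ B.card := by
  induction B using Finset.induction_on_max with
  | empty => simp [code]
  | insert v A h ih =>
    rw [code_insert h, Finset.card_insert_of_notMem fun h' => (h v h').false, pow_succ]
    have h₁ : ((σ v : ℕ) + 1) * q ^ A.card ≤ q * q ^ A.card :=
      Nat.mul_le_mul_right _ (σ v).isLt
    linarith

theorem code_inj {B : Finset (Fin n)} {σ τ : Fin n → Fin q} (h : code B σ = code B τ) :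
    ∀ v ∈ B, σ v = τ v := by
  induction B using Finset.induction_on_max with
  | empty => simp
  | insert v A hA ih =>
    rw [code_insert hA, code_insert hA] at h
    have hσ := code_lt A σ
    have hτ := code_lt A τ
    have hpos : 0 < q ^ A.card := by omega
    have h₁ := congrArg (· % q ^ A.card) h
    have h₂ := congrArg (· / q ^ A.card) h
    simp only [Nat.add_mul_mod_self_right, Nat.mod_eq_of_lt hσ, Nat.mod_eq_of_lt hτ] at h₁
    simp only [Nat.add_mul_div_right _ _ hpos, Nat.div_eq_of_lt hσ, Nat.div_eq_of_lt hτ,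
      zero_add] at h₂
    intro u hu
    rcases Finset.mem_insert.1 hu with rfl | hu
    · exact Fin.ext h₂
    · exact ih h₁ u hu

theorem code_div_mod (B : Finset (Fin n)) (σ : Fin n → Fin q) {v : Fin n} (h : v ∈ B) :
    code B σ / q ^ (below B v).card % q = σ v := by
  have hq : 0 < q := (σ v).pos
  -- The vertices below `k` supply the low digits; every other digit has a place value divisible by
  -- `q ^ (below B k).card`.
  have hsplit : ∀ k : ℕ, ∃ r, code B σ = code (below B k) σ + q ^ (below B k).card * r := by
    intro k
    have h₁ : code (below B k) σ =
        ∑ v ∈ below B k, (σ v : ℕ) * q ^ (B.filter (· < v)).card := by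
      refine Finset.sum_congr rfl fun u hu => ?_
      have : (below B k).filter (· < u) = B.filter (· < u) := by
        have hu := (Finset.mem_filter.1 hu).2
        ext w
        simp only [below, Finset.mem_filter, Fin.lt_def, and_assoc]
        exact and_congr_right fun _ => ⟨fun h => h.2, fun h => ⟨by omega, h⟩⟩
      rw [this]
    have h₂ : q ^ (below B k).card ∣
        ∑ v ∈ B.filter (fun v : Fin n => ¬ (v : ℕ) < k), (σ v : ℕ) * q ^ (B.filter (· < v)).card := by
      refine Finset.dvd_sum fun u hu => Dvd.dvd.mul_left (pow_dvd_pow _ (Finset.card_le_card ?_)) _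
      intro w hw
      simp only [below, Finset.mem_filter] at hu hw ⊢
      exact ⟨hw.1, by rw [Fin.lt_def]; omega⟩
    obtain ⟨r, hr⟩ := h₂
    refine ⟨r, ?_⟩
    rw [← hr, h₁, code, below, Finset.sum_filter_add_sum_filter_not]
  obtain ⟨r, hr⟩ := hsplit (v + 1)
  rw [card_below_succ_of_mem h, below_succ_of_mem h, code_insert lt_of_mem_below] at hr
  have hlt := code_lt (below B v) σ
  have hpos : 0 < q ^ (below B (v : ℕ)).card := Nat.pow_pos hq
  have e : code B σ = code (below B v) σ + ((σ v : ℕ) + q * r) * q ^ (below B (v : ℕ)).card := by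
    rw [hr]; ring
  rw [e, Nat.add_mul_div_right _ _ hpos, Nat.div_eq_of_lt hlt, zero_add, Nat.add_mul_mod_self_left,
    Nat.mod_eq_of_lt (σ v).isLt]

variable [NeZero q]

/-- The colorings that are `0` outside of `B`. -/
def cols (q : ℕ) [NeZero q] (B : Finset (Fin n)) : Finset (Fin n → Fin q) :=
  Finset.univ.filter fun σ => ∀ v, v ∉ B → σ v = 0

theorem mem_cols {B : Finset (Fin n)} {σ : Fin n → Fin q} :
    σ ∈ cols q B ↔ ∀ v, v ∉ B → σ v = 0 := by simp [cols]

/-- The coloring that agrees with `σ` on `B` and is `0` elsewhere. -/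
def restrict (B : Finset (Fin n)) (σ : Fin n → Fin q) : Fin n → Fin q :=
  fun v => if v ∈ B then σ v else 0

theorem restrict_mem_cols (B : Finset (Fin n)) (σ : Fin n → Fin q) : restrict B σ ∈ cols q B :=
  mem_cols.2 fun _ hv => if_neg hv

theorem restrict_of_mem {B : Finset (Fin n)} (σ : Fin n → Fin q) {v : Fin n} (h : v ∈ B) :
    restrict B σ v = σ v := if_pos h

theorem eq_of_code_eq {B : Finset (Fin n)} {σ τ : Fin n → Fin q} (hσ : σ ∈ cols q B)
    (hτ : τ ∈ cols q B) (h : code B σ = code B τ) : σ = τ := by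
  funext v
  by_cases hv : v ∈ B
  · exact code_inj h v hv
  · rw [mem_cols.1 hσ v hv, mem_cols.1 hτ v hv]

theorem exists_code_eq {B : Finset (Fin n)} {c : ℕ} (hc : c < q ^ B.card) :
    ∃ σ ∈ cols q B, code B σ = c := by
  induction B using Finset.induction_on_max generalizing c with
  | empty =>
    refine ⟨0, mem_cols.2 fun _ _ => rfl, ?_⟩
    simp only [Finset.card_empty, pow_zero, Nat.lt_one_iff] at hc
    rw [code_empty, hc]
  | insert v A hA ih =>
    have hv : v ∉ A := fun h => (hA v h).false
    rw [Finset.card_insert_of_notMem hv, pow_succ] at hc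
    have hpos : 0 < q ^ A.card := Nat.pow_pos (NeZero.pos q)
    obtain ⟨σ, hσ, hσc⟩ := ih (Nat.mod_lt c hpos)
    refine ⟨Function.update σ v ⟨c / q ^ A.card, Nat.div_lt_of_lt_mul hc⟩, ?_, ?_⟩
    · refine mem_cols.2 fun u hu => ?_
      rw [Finset.mem_insert, not_or] at hu
      rw [Function.update_of_ne hu.1]
      exact mem_cols.1 hσ u hu.2
    · rw [code_insert hA, Function.update_self, code_congr (τ := σ), hσc]
      · exact Nat.mod_add_div' c _
      · intro u hu
        exact Function.update_of_ne (hA u hu).ne _ _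

/-- Summing out the vertices that occur in `X` only. -/
theorem sum_eliminate {U X : Finset (Fin n)} {H F : (Fin n → Fin q) → ℂ}
    (hH : ∀ σ τ, (∀ v ∈ U, σ v = τ v) → H σ = H τ)
    (hF : ∀ σ τ, (∀ v ∈ X, σ v = τ v) → F σ = F τ) :
    ∑ σ ∈ cols q (U ∪ X), H σ * F σ =
      ∑ σ ∈ cols q U, H σ * ∑ τ ∈ (cols q X).filter (fun τ => ∀ v ∈ U ∩ X, τ v = σ v), F τ := by
  simp_rw [Finset.mul_sum]
  rw [Finset.sum_sigma']
  symm
  -- A pair `(σ, τ)` that agrees on `U ∩ X` is glued to a coloring of `U ∪ X`; the inverse restricts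
  -- to `U` and to `X`.
  refine Finset.sum_bij' (fun z _ => fun v => if v ∈ X then z.2 v else z.1 v)
    (fun σ _ => ⟨restrict U σ, restrict X σ⟩) ?_ ?_ ?_ ?_ ?_
  · rintro ⟨σ, τ⟩ h
    simp only [Finset.mem_sigma, Finset.mem_filter, mem_cols] at h
    refine mem_cols.2 fun v hv => ?_
    rw [Finset.mem_union, not_or] at hv
    simp only [hv.2, if_false]
    exact h.1 v hv.1
  · intro σ _
    simp only [Finset.mem_sigma, Finset.mem_filter, restrict_mem_cols, true_and, Finset.mem_inter]
    rintro v ⟨hU, hX⟩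
    rw [restrict_of_mem σ hU, restrict_of_mem σ hX]
  · rintro ⟨σ, τ⟩ h
    simp only [Finset.mem_sigma, Finset.mem_filter, mem_cols, Finset.mem_inter] at h
    obtain ⟨hσ, hτ, h⟩ := h
    congr 1
    · funext v
      by_cases hU : v ∈ U
      · rw [restrict_of_mem _ hU]
        split_ifs with hX
        · exact h v ⟨hU, hX⟩
        · rfl
      · simp [restrict, hU, hσ]
    · funext v
      by_cases hX : v ∈ X
      · rw [restrict_of_mem _ hX, if_pos hX]
      · simp [restrict, hX, hτ]
  · intro σ h
    funext v
    by_cases hX : v ∈ X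
    · simp [restrict, hX]
    · by_cases hU : v ∈ U
      · simp [restrict, hX, hU]
      · simp [restrict, hX, hU, mem_cols.1 h v (by simp [hX, hU])]
  · rintro ⟨σ, τ⟩ h
    simp only [Finset.mem_sigma, Finset.mem_filter, mem_cols, Finset.mem_inter] at h
    obtain ⟨hσ, hτ, h⟩ := h
    congr 1
    · refine hH _ _ fun v hU => ?_
      by_cases hX : v ∈ X
      · simp only [if_pos hX, h v ⟨hU, hX⟩]
      · simp only [if_neg hX]
    · exact hF _ _ fun v hX => (if_pos hX).symm

end Coloring

/-! ## The Potts partition function -/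

namespace Multigraph

variable {n m : ℕ}

/-- The partition function with weight `x` for monochromatic and weight `y` for other edges. -/
noncomputable def potts (q : ℕ) (G : Multigraph n m) (x y : ℂ) : ℂ :=
  ∑ σ : Fin n → Fin q, ∏ e, if σ (G.ends e).1 = σ (G.ends e).2 then x else y

theorem eq_of_reachable (G : Multigraph n m) {q : ℕ} {A : Finset (Fin m)} {σ : Fin n → Fin q}
    (h : ∀ e ∈ A, σ (G.ends e).1 = σ (G.ends e).2) {u v : Fin n}
    (huv : (G.spanning A).Reachable u v) : σ u = σ v := by
  obtain ⟨p⟩ := huv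
  induction p with
  | nil => rfl
  | cons hadj _ ih =>
    refine Eq.trans ?_ ih
    rw [spanning, SimpleGraph.fromRel_adj] at hadj
    obtain ⟨-, ⟨e, he, h'⟩ | ⟨e, he, h'⟩⟩ := hadj
    · simpa [h'] using h e he
    · simpa [h'] using (h e he).symm

theorem reachable_ends (G : Multigraph n m) {A : Finset (Fin m)} {e : Fin m} (he : e ∈ A) :
    (G.spanning A).Reachable (G.ends e).1 (G.ends e).2 := by
  by_cases h : (G.ends e).1 = (G.ends e).2
  · rw [h]
  · exact SimpleGraph.Adj.reachable (SimpleGraph.fromRel_adj _ _ _ |>.2 ⟨h, .inl ⟨e, he, rfl⟩⟩)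

/-- A coloring that is constant along the edges of `A` is constant on the components of `(V, A)`,
hence is the same as a function on the set of components. -/
theorem card_monochromatic (q : ℕ) (G : Multigraph n m) (A : Finset (Fin m)) :
    (Finset.univ.filter fun σ : Fin n → Fin q =>
      ∀ e ∈ A, σ (G.ends e).1 = σ (G.ends e).2).card = q ^ G.numComponents A := by
  classical
  let f : {σ : Fin n → Fin q // ∀ e ∈ A, σ (G.ends e).1 = σ (G.ends e).2} ≃
      ((G.spanning A).ConnectedComponent → Fin q) :=
    { toFun := fun σ c => c.lift σ.1 fun _ _ p _ => G.eq_of_reachable σ.2 p.reachable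
      invFun := fun g => ⟨fun v => g ((G.spanning A).connectedComponentMk v), fun e he =>
        congrArg g (SimpleGraph.ConnectedComponent.sound (G.reachable_ends he))⟩
      left_inv := fun σ => rfl
      right_inv := fun g => by
        funext c
        induction c using SimpleGraph.ConnectedComponent.ind
        rfl }
  rw [← Fintype.card_subtype, ← Nat.card_eq_fintype_card, Nat.card_congr f, Nat.card_fun,
    Nat.card_eq_fintype_card, Fintype.card_fin, numComponents]

theorem prod_monochromatic (q : ℕ) (G : Multigraph n m) (A : Finset (Fin m)) :
    ∑ σ : Fin n → Fin q, ∏ e ∈ A, (if σ (G.ends e).1 = σ (G.ends e).2 then (1 : ℂ) else 0) =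
      (q : ℂ) ^ G.numComponents A := by
  simp_rw [Finset.prod_ite_zero, Finset.prod_const_one]
  rw [Finset.sum_boole, card_monochromatic]
  simp

/-- With weights 1 and 0 only the colorings constant on components contribute. This is how the
program learns `k(E)`. -/
theorem potts_one_zero (q : ℕ) (G : Multigraph n m) :
    G.potts q 1 0 = (q : ℂ) ^ G.numComponents Finset.univ :=
  G.prod_monochromatic q Finset.univ

/-- Fortuin–Kasteleyn expansion: each edge factor is 1 plus `y - 1` times the indicator of being
monochromatic, and the product is expanded over edge sets. -/
theorem potts_eq_sum (q : ℕ) (G : Multigraph n m) (y : ℂ) :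
    G.potts q y 1 = ∑ A : Finset (Fin m), (q : ℂ) ^ G.numComponents A * (y - 1) ^ A.card := by
  have h : ∀ σ : Fin n → Fin q, (∏ e, if σ (G.ends e).1 = σ (G.ends e).2 then y else 1) =
      ∑ A : Finset (Fin m),
        (∏ e ∈ A, if σ (G.ends e).1 = σ (G.ends e).2 then (1 : ℂ) else 0) * (y - 1) ^ A.card := by
    intro σ
    have : ∀ e, (if σ (G.ends e).1 = σ (G.ends e).2 then y else 1) =
        1 + (if σ (G.ends e).1 = σ (G.ends e).2 then (1 : ℂ) else 0) * (y - 1) := by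
      intro e; split_ifs <;> ring
    simp_rw [this, Finset.prod_one_add, Finset.powerset_univ, Finset.prod_mul_distrib,
      Finset.prod_const]
  simp_rw [potts, h]
  rw [Finset.sum_comm]
  simp_rw [← Finset.sum_mul, prod_monochromatic]

/-- The identity holds term by term in `A`: the power of `q = (a - 1) * (b - 1)` splits into powers
of the two factors. Both are nonzero because `q ≠ 0`, so the integer exponents can be separated. -/
theorem tutte_mul (q : ℕ) (hq : q ≠ 0) (G : Multigraph n m) {a b : ℂ}
    (hab : (a, b) ∈ hyperbola (q : ℂ)) :
    G.potts q b 1 / (b - 1) ^ n / (a - 1) ^ G.numComponents Finset.univ = G.tutte a b := by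
  have h : (a - 1) * (b - 1) = q := hab
  have hq' : (q : ℂ) ≠ 0 := Nat.cast_ne_zero.2 hq
  have ha : a - 1 ≠ 0 := fun e => hq' (by rw [← h, e, zero_mul])
  have hb : b - 1 ≠ 0 := fun e => hq' (by rw [← h, e, mul_zero])
  rw [potts_eq_sum, tutte, Finset.sum_div, Finset.sum_div]
  refine Finset.sum_congr rfl fun A _ => ?_
  rw [zpow_sub₀ ha, zpow_sub₀ hb, zpow_add₀ hb, ← h, mul_pow]
  simp only [zpow_natCast]
  ring

theorem numComponents_le (G : Multigraph n m) (A : Finset (Fin m)) : G.numComponents A ≤ n := by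
  have := Nat.card_le_card_of_surjective (G.spanning A).connectedComponentMk Quot.mk_surjective
  simpa [numComponents] using this

end Multigraph

/-! ## Removing the leaves of a tree one after the other -/

namespace SimpleGraph

variable {V : Type*} {T : SimpleGraph V}

/-- Every nonempty proper subset of `A` is joined by an edge to the rest of `A`. -/
def CutConnected (T : SimpleGraph V) (A : Set V) : Prop :=
  ∀ B ⊆ A, B.Nonempty → B ≠ A → ∃ u ∈ B, ∃ w ∈ A, w ∉ B ∧ T.Adj u w

/-- A walk that starts in `B` and ends outside has an edge leaving `B`. The cut form avoids induced
subgraphs when leaves are deleted, and it holds for the empty set, which occurs once all nodes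
containing a given vertex are gone. -/
theorem Preconnected.cutConnected {A : Set V} (h : (T.induce A).Preconnected) :
    T.CutConnected A := by
  rintro B hBA ⟨u, hu⟩ hne
  obtain ⟨w, hwA, hwB⟩ : ∃ w ∈ A, w ∉ B := by
    by_contra! h'
    exact hne (hBA.antisymm h')
  obtain ⟨p⟩ := h ⟨u, hBA hu⟩ ⟨w, hwA⟩
  obtain ⟨d, -, h₁, h₂⟩ := p.exists_boundary_dart (Subtype.val ⁻¹' B) hu hwB
  exact ⟨d.fst, h₁, d.snd, d.snd.2, h₂, d.adj⟩

theorem CutConnected.preconnected {A : Set V} (h : T.CutConnected A) :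
    (T.induce A).Preconnected := by
  intro u v
  by_contra hne
  obtain ⟨w, ⟨w', hw, rfl⟩, z, hz, hzB, hadj⟩ :=
    h (Subtype.val '' {w : A | (T.induce A).Reachable u w}) (by simp)
      ⟨u, u, Reachable.refl _, rfl⟩ (fun e => by
        obtain ⟨v', hv', e'⟩ := e.ge v.2
        exact hne (Subtype.ext e' ▸ hv'))
  exact hzB ⟨⟨z, hz⟩, Reachable.trans hw (Adj.reachable (by simpa using hadj)), rfl⟩

/-- `p` is the only neighbor of `x` in `S`. -/
def IsLeafAt (T : SimpleGraph V) (S : Set V) (x p : V) : Prop :=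
  x ∈ S ∧ p ∈ S ∧ T.Adj x p ∧ ∀ y ∈ S, T.Adj x y → y = p

theorem IsLeafAt.cutConnected_diff {S A : Set V} {x p : V} (hl : T.IsLeafAt S x p) (hAS : A ⊆ S)
    (hA : T.CutConnected A) : T.CutConnected (A \ {x}) := by
  by_cases hx : x ∈ A
  swap
  · rwa [Set.sdiff_singleton_eq_self hx]
  intro B hBA hB hne
  have hxB : x ∉ B := fun h => (hBA h).2 rfl
  -- If `p ∈ B`, cut `A` along `B ∪ {x}`: the crossing edge cannot start at `x`, whose only neighbor
  -- `p` is inside. If `p ∉ B`, cut along `B`: the crossing edge cannot end at `x`, as it would have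
  -- to start at `p`.
  by_cases hp : p ∈ B
  · obtain ⟨u, hu, w, hw, hwB, hadj⟩ := hA (insert x B)
      (Set.insert_subset hx (hBA.trans Set.sdiff_subset)) ⟨x, by simp⟩ (fun e => hne (by
        rw [← e, Set.insert_sdiff_self_of_notMem hxB]))
    rw [Set.mem_insert_iff, not_or] at hwB
    refine ⟨u, ?_, w, ⟨hw, hwB.1⟩, hwB.2, hadj⟩
    rcases hu with rfl | hu
    · exact absurd hp (hl.2.2.2 w (hAS hw) hadj ▸ hwB.2)
    · exact hu
  · obtain ⟨u, hu, w, hw, hwB, hadj⟩ := hA B (hBA.trans Set.sdiff_subset) hB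
      (fun e => hxB (e ▸ hx))
    refine ⟨u, hu, w, ⟨hw, fun e => ?_⟩, hwB, hadj⟩
    obtain rfl : w = x := e
    exact hp (hl.2.2.2 u (hAS (hBA hu).1) hadj.symm ▸ hu)

/-- Some edge leaves `{x}` inside `A`, and it can only lead to `p`. Applied to the nodes containing
a fixed vertex, this says that a vertex shared by the leaf and any other remaining bag lies in the
bag of `p`. -/
theorem IsLeafAt.mem_of_cutConnected {S A : Set V} {x p y : V} (hl : T.IsLeafAt S x p) (hAS : A ⊆ S)
    (hA : T.CutConnected A) (hx : x ∈ A) (hy : y ∈ A) (hne : y ≠ x) : p ∈ A := by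
  obtain ⟨u, hu, w, hw, -, hadj⟩ := hA {x} (by simpa) ⟨x, rfl⟩ (fun e => hne (by rw [← e] at hy; exact hy))
  obtain rfl : u = x := hu
  exact hl.2.2.2 w (hAS hw) hadj ▸ hw

theorem IsAcyclic.exists_isLeafAt [Finite V] (hT : T.IsAcyclic) {S : Set V} (hS : T.CutConnected S)
    (hne : S.Nontrivial) : ∃ x p, T.IsLeafAt S x p := by
  classical
  have := Fintype.ofFinite V
  have : Nontrivial S := hne.coe_sort
  have ht : (T.induce S).IsTree := ⟨⟨hS.preconnected⟩, hT.induce S⟩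
  obtain ⟨x, hx⟩ := ht.exists_vert_degree_one_of_nontrivial
  obtain ⟨p, hp, h⟩ := degree_eq_one_iff_existsUnique_adj.1 hx
  exact ⟨x, p, x.2, p.2, by simpa using hp, fun y hy hadj =>
    congrArg Subtype.val (h ⟨y, hy⟩ (by simpa using hadj))⟩

end SimpleGraph

namespace RAM

open Coloring

/-! ## Programs for tree decompositions

The word registers `0`, …, `5` hold `n`, `m`, `N`, `1`, `q`, `0`, and the word register `10` holds the
current node of the tree. Colorings are kept in the word array `4`. -/

theorem Tr.skip_of_pos {W T : ℕ} {s : State} {Q : State → Prop} (h : Q s) (hT : 1 ≤ T) :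
    Tr W .skip T s Q := (Tr.skip h).mono hT fun _ _ h => h

section

variable {n m N : ℕ} {G : Multigraph n m}

/-- The input and the constants are in place. -/
structure Base (q : ℕ) (D : TreeDecomposition G N) (s : State) : Prop where
  w0 : s.wreg 0 = n
  w1 : s.wreg 1 = m
  w2 : s.wreg 2 = N
  w3 : s.wreg 3 = 1
  w4 : s.wreg 4 = q
  w5 : s.wreg 5 = 0
  ends₁ : ∀ e : Fin m, s.warr 0 e = (G.ends e).1
  ends₂ : ∀ e : Fin m, s.warr 1 e = (G.ends e).2
  adj : ∀ x y : Fin N, s.warr 2 (x * N + y) = 1 ↔ D.tree.Adj x y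
  mem : ∀ (x : Fin N) (v : Fin n), s.warr 3 (x * n + v) = 1 ↔ v ∈ D.bag x
  adj_le : ∀ x y : Fin N, s.warr 2 (x * N + y) ≤ 1
  mem_le : ∀ (x : Fin N) (v : Fin n), s.warr 3 (x * n + v) ≤ 1

/-- The program changes neither the input nor the constants. -/
def Program.Quiet (p : Program) : Prop :=
  (∀ i ∈ [0, 1, 2, 3, 4, 5], p.writesW i = false) ∧ ∀ r ∈ [0, 1, 2, 3], p.writesWA r = false

instance (p : Program) : Decidable p.Quiet := inferInstanceAs (Decidable (_ ∧ _))

/-- `K`, `L` and `W` bound the input. -/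
structure Fits (q : ℕ) (D : TreeDecomposition G N) (K L W : ℕ) : Prop where
  n_le : n ≤ L
  m_le : m ≤ L
  N_le : N ≤ L
  one_le_L : 1 ≤ L
  one_le_K : 1 ≤ K
  pow_le : ∀ x, q ^ (D.bag x).card ≤ K
  pow_lt : ∀ x, q ^ (D.bag x).card * N < W
  Nn_lt : N * n < W
  NN_lt : N * N < W
  L_lt : L < W
  q_lt : q < W
  one_lt : 1 < W

variable {q : ℕ} {D : TreeDecomposition G N} {K L W : ℕ} {p p₁ p₂ : Program} {T : ℕ}
  {s s' : State} {Q : State → Prop}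

theorem Base.of_frame (h : Base q D s) (hf : Frame p s s') (hp : p.Quiet) : Base q D s' := by
  obtain ⟨hw, ha⟩ := hp
  have e0 := hf.wa 0 (ha 0 (by decide))
  have e1 := hf.wa 1 (ha 1 (by decide))
  have e2 := hf.wa 2 (ha 2 (by decide))
  have e3 := hf.wa 3 (ha 3 (by decide))
  constructor
  · rw [hf.w 0 (hw 0 (by decide)), h.w0]
  · rw [hf.w 1 (hw 1 (by decide)), h.w1]
  · rw [hf.w 2 (hw 2 (by decide)), h.w2]
  · rw [hf.w 3 (hw 3 (by decide)), h.w3]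
  · rw [hf.w 4 (hw 4 (by decide)), h.w4]
  · rw [hf.w 5 (hw 5 (by decide)), h.w5]
  · rw [e0]; exact h.ends₁
  · rw [e1]; exact h.ends₂
  · rw [e2]; exact h.adj
  · rw [e3]; exact h.mem
  · rw [e2]; exact h.adj_le
  · rw [e3]; exact h.mem_le

theorem mul_add_lt {x k v B : ℕ} (hx : x < k) (hv : v < B) : x * B + v < k * B :=
  calc x * B + v < x * B + B := by omega
    _ = (x + 1) * B := by ring
    _ ≤ k * B := Nat.mul_le_mul_right _ hx

theorem mul_add_inj {x y v w B : ℕ} (hv : v < B) (hw : w < B) (h : x * B + v = y * B + w) :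
    x = y ∧ v = w := by
  have hB : 0 < B := by omega
  have h₁ := congrArg (· / B) h
  have h₂ := congrArg (· % B) h
  simp only [mul_comm x, mul_comm y, Nat.mul_add_div hB, Nat.div_eq_of_lt hv, Nat.div_eq_of_lt hw,
    Nat.mul_add_mod, Nat.mod_eq_of_lt hv, Nat.mod_eq_of_lt hw] at h₁ h₂
  exact ⟨by simpa using h₁, h₂⟩

/-- Load the bit that tells if the vertex in register `20` is in the bag of the node in register
`y`. -/
def memBlock (y : ℕ) : Program := block [.wop .mul 21 y 0, .wop .add 21 21 20, .wload 22 3 21]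

def ifMem (y : ℕ) (p₁ p₂ : Program) : Program := .seq (memBlock y) (.ite (.weq 22 3) p₁ p₂)

theorem Tr.ifMem (hF : Fits q D K L W) (hB : Base q D s) {y : ℕ} {x : Fin N} {v : Fin n}
    (hx : s.wreg y = x) (hv : s.wreg 20 = v)
    (h₁ : v ∈ D.bag x → ∀ s₁, Frame (memBlock y) s s₁ → Tr W p₁ T s₁ Q)
    (h₂ : v ∉ D.bag x → ∀ s₁, Frame (memBlock y) s s₁ → Tr W p₂ T s₁ Q) :
    Tr W (ifMem y p₁ p₂) (T + 5) s Q := by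
  have hlt : (x : ℕ) * n + v < W := (mul_add_lt x.2 v.2).trans hF.Nn_lt
  have : Tr W (memBlock y) 4 s fun s₁ => s₁.wreg 22 = 1 ↔ v ∈ D.bag x := by
    refine Tr.block ?_ ?_
    · simp [Safes, Instr.Safe, Instr.exec, WordOp.eval, hx, hv, hB.w0, hlt]
      omega
    · simpa [execs, Instr.exec, WordOp.eval, hx, hv, hB.w0] using hB.mem x v
  refine (this.seq (T₂ := T + 1) fun s₁ hf hs₁ => ?_).mono (by omega) fun _ _ h => h
  have h3 : s₁.wreg 3 = 1 := (hf.w 3 rfl).trans hB.w3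
  refine Tr.ite (fun hb => h₁ ?_ s₁ hf) (fun hb => h₂ ?_ s₁ hf)
  · simpa [Test.holds, h3, hs₁] using hb
  · simpa [Test.holds, h3, hs₁] using hb

/-- `wreg 12 := q ^ |B_x|` where `x = wreg 10`. -/
def sizeProg : Program :=
  .seq (block [.wconst 12 1]) (forLoop 20 0 (ifMem 10 (block [.wop .mul 12 12 4]) .skip))

theorem Tr.sizeProg (hF : Fits q D K L W) (hB : Base q D s) {x : Fin N} (hx : s.wreg 10 = x)
    (hq : 0 < q) :
    Tr W sizeProg (14 * L) s fun s' => s'.wreg 12 = q ^ (D.bag x).card := by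
  have hpow : ∀ k, q ^ (below (D.bag x) k).card < W := fun k =>
    (Nat.pow_le_pow_right hq (card_below_le _ _)).trans_lt
      ((Nat.le_mul_of_pos_right _ x.pos).trans_lt (hF.pow_lt x))
  have h₁ : Tr W (RAM.block [.wconst 12 1]) 2 s fun s' => s'.wreg 12 = 1 :=
    Tr.block (by simp [Safes, Instr.Safe, hF.one_lt]) (by simp [execs, Instr.exec])
  refine (h₁.seq (T₂ := n * (7 + 2) + 2) fun s₁ hf₁ hs₁ => ?_).mono ?_ fun _ _ h => h
  · have hB₁ := hB.of_frame hf₁ (by decide)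
    refine Tr.forLoop (fun j s => s.wreg 12 = q ^ (below (D.bag x) j).card) hB₁.w0 hB₁.w3
      (by decide) (by decide) ⟨rfl, rfl, rfl⟩ (by simp [hs₁, below_zero]) ?_ ?_
    · intro j hj s₂ hf₂ hi hI
      have hB₂ := hB₁.of_frame hf₂ (by decide)
      have hx₂ : s₂.wreg 10 = x := by rw [hf₂.w 10 rfl, hf₁.w 10 rfl, hx]
      refine Tr.ifMem hF hB₂ hx₂ (v := ⟨j, hj⟩) hi (fun hv s₃ hf₃ => ?_)
        (fun hv s₃ hf₃ => ?_)
      · have hc := card_below_succ_of_mem hv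
        have hp := hpow (j + 1)
        simp only at hc
        rw [hc, pow_succ] at hp
        have e : s₃.wreg 12 * s₃.wreg 4 = q ^ (below (D.bag x) j).card * q := by
          rw [hf₃.w 12 rfl, hf₃.w 4 rfl, hI, hB₂.w4]
        refine Tr.block ?_ ?_
        · simpa [Safes, Instr.Safe, WordOp.eval, e] using hp
        · simp [execs, Instr.exec, WordOp.eval, e, hc, pow_succ]
      · refine Tr.skip_of_pos ?_ (by simp)
        have hc := below_succ_of_notMem hv
        simp only at hc
        simp [hc, hf₃.w 12 rfl, hI]
    · intro s₂ _ hI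
      rw [hI, below_self]
  · have := hF.n_le
    have := hF.one_le_L
    omega

/-- The coloring in the word array `4` is `σ`. -/
def IsCol (s : State) (σ : Fin n → Fin q) : Prop := ∀ v : Fin n, s.warr 4 v = σ v

/-- Write the coloring of the bag of the node `wreg 10` with code `wreg 23` into the word array
`4`. -/
def decode : Program :=
  -- Adding register 5, which holds `0`, copies a register. Vertices outside the bag receive color
  -- `0`, in accordance with `cols`.
  .seq (block [.wop .add 24 23 5]) (forLoop 20 0 (ifMem 10
    (block [.wop .mod 25 24 4, .wstore 4 20 25, .wop .div 24 24 4]) (block [.wstore 4 20 5])))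

theorem Tr.decode [NeZero q] (hF : Fits q D K L W) (hB : Base q D s) {x : Fin N}
    (hx : s.wreg 10 = x) {σ : Fin n → Fin q} (hσ : σ ∈ cols q (D.bag x))
    (hc : s.wreg 23 = code (D.bag x) σ) :
    Tr W decode (16 * L) s fun s' => IsCol s' σ := by
  have hcW : code (D.bag x) σ < W := (code_lt _ _).trans
    ((Nat.le_mul_of_pos_right _ x.pos).trans_lt (hF.pow_lt x))
  have h₁ : Tr W (RAM.block [.wop .add 24 23 5]) 2 s fun s' => s'.wreg 24 = code (D.bag x) σ :=
    Tr.block (by simpa [Safes, Instr.Safe, WordOp.eval, hc, hB.w5])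
      (by simp [execs, Instr.exec, WordOp.eval, hc, hB.w5])
  refine (h₁.seq (T₂ := n * (9 + 2) + 2) fun s₁ hf₁ hs₁ => ?_).mono ?_ fun _ _ h => h
  · have hB₁ := hB.of_frame hf₁ (by decide)
    -- Each vertex of the bag strips the lowest digit, so register 24 holds the digits not yet read.
    refine Tr.forLoop (fun j s => s.wreg 24 = code (D.bag x) σ / q ^ (below (D.bag x) j).card ∧
      ∀ v : Fin n, (v : ℕ) < j → s.warr 4 v = σ v) hB₁.w0 hB₁.w3
      (by decide) (by decide) ⟨rfl, rfl, rfl⟩ (by simp [hs₁, below_zero]) ?_ ?_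
    · intro j hj s₂ hf₂ hi hI
      have hB₂ := hB₁.of_frame hf₂ (by decide)
      have hx₂ : s₂.wreg 10 = x := by rw [hf₂.w 10 rfl, hf₁.w 10 rfl, hx]
      have hor : ∀ {v : Fin n}, (v : ℕ) < j + 1 → (v : ℕ) ≠ j → (v : ℕ) < j := by omega
      refine Tr.ifMem hF hB₂ hx₂ (v := ⟨j, hj⟩) hi (fun hv s₃ hf₃ => ?_)
        (fun hv s₃ hf₃ => ?_)
      · have hcard := card_below_succ_of_mem hv
        have hdm := code_div_mod (D.bag x) σ hv
        simp only at hcard hdm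
        have e24 : s₃.wreg 24 = code (D.bag x) σ / q ^ (below (D.bag x) j).card := by
          rw [hf₃.w 24 rfl, hI.1]
        have e4 : s₃.wreg 4 = q := by rw [hf₃.w 4 rfl, hB₂.w4]
        have e20 : s₃.wreg 20 = j := by rw [hf₃.w 20 rfl, hi]
        refine Tr.block ?_ ?_
        · simp only [Safes, Instr.Safe, Instr.exec, WordOp.eval, e24, e4, and_true,
            State.setWReg_wreg, State.setWArr_wreg, true_and]
          refine ⟨by rw [hdm]; exact (σ _).2.trans hF.q_lt, ?_⟩
          simp only [show (24 : ℕ) ≠ 25 by decide, if_false, show (4 : ℕ) ≠ 25 by decide]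
          exact (Nat.div_le_self _ _).trans_lt ((Nat.div_le_self _ _).trans_lt hcW)
        · refine ⟨?_, fun v hv => ?_⟩
          · simp [execs, Instr.exec, WordOp.eval, e24, e4, hcard, pow_succ, Nat.div_div_eq_div_mul]
          · by_cases hvj : (v : ℕ) = j
            · obtain rfl : v = ⟨j, hj⟩ := Fin.ext hvj
              simp [execs, Instr.exec, WordOp.eval, e24, e4, e20, hdm]
            · simp [execs, Instr.exec, e20, hvj, hf₃.wa 4 rfl, hI.2 v (hor hv hvj)]
      · have hc := below_succ_of_notMem hv
        simp only at hc
        refine (Tr.block (by simp [Safes, Instr.Safe]) (Q := fun s' => _) ?_).mono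
          (by simp) fun _ _ h => h
        refine ⟨?_, fun v hv => ?_⟩
        · simp [execs, Instr.exec, hc, hf₃.w 24 rfl, hI.1]
        · by_cases hvj : (v : ℕ) = j
          · obtain rfl : v = ⟨j, hj⟩ := Fin.ext hvj
            simp [execs, Instr.exec, hf₃.w 20 rfl, hf₃.w 5 rfl, hi, hB₂.w5,
              mem_cols.1 hσ _ ‹_›]
          · simp [execs, Instr.exec, hf₃.w 20 rfl, hi, hvj, hf₃.wa 4 rfl, hI.2 v (hor hv hvj)]
    · intro s₂ _ hI v
      exact hI.2 v v.2
  · have := hF.n_le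
    have := hF.one_le_L
    omega

/-- `wreg 13` becomes the code of the coloring of the vertices that the nodes `wreg 10` and `wreg 11`
have in common. -/
def encode : Program :=
  .seq (block [.wconst 13 0, .wconst 14 1]) (forLoop 20 0 (ifMem 10 (ifMem 11
    (block [.wload 25 4 20, .wop .mul 25 25 14, .wop .add 13 13 25, .wop .mul 14 14 4])
    .skip) .skip))

theorem Tr.encode (hF : Fits q D K L W) (hB : Base q D s) {x y : Fin N}
    (hx : s.wreg 10 = x) (hy : s.wreg 11 = y) {σ : Fin n → Fin q} (hσ : IsCol s σ) (hq : 0 < q) :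
    Tr W encode (22 * L) s fun s' => s'.wreg 13 = code (D.bag x ∩ D.bag y) σ := by
  set B := D.bag x ∩ D.bag y with hBdef
  have hpow : ∀ k, q ^ (below B k).card < W := fun k =>
    (Nat.pow_le_pow_right hq ((card_below_le _ _).trans
      (Finset.card_le_card Finset.inter_subset_left))).trans_lt
      ((Nat.le_mul_of_pos_right _ x.pos).trans_lt (hF.pow_lt x))
  have h₁ : Tr W (RAM.block [.wconst 13 0, .wconst 14 1]) 3 s
      fun s' => s'.wreg 13 = 0 ∧ s'.wreg 14 = 1 :=
    Tr.block (by simp [Safes, Instr.Safe, hF.one_lt]; exact (Nat.zero_le _).trans_lt hF.one_lt)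
      (by simp [execs, Instr.exec])
  refine (h₁.seq (T₂ := n * (15 + 2) + 2) fun s₁ hf₁ hs₁ => ?_).mono ?_ fun _ _ h => h
  · have hB₁ := hB.of_frame hf₁ (by decide)
    -- Register 13 is the code of the vertices read so far, register 14 the place value of the next
    -- digit.
    refine Tr.forLoop (fun j s => s.wreg 13 = code (below B j) σ ∧
      s.wreg 14 = q ^ (below B j).card) hB₁.w0 hB₁.w3
      (by decide) (by decide) ⟨rfl, rfl, rfl⟩ (by simp [hs₁, below_zero, code_empty]) ?_ ?_
    · intro j hj s₂ hf₂ hi hI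
      have hB₂ := hB₁.of_frame hf₂ (by decide)
      have hx₂ : s₂.wreg 10 = x := by rw [hf₂.w 10 rfl, hf₁.w 10 rfl, hx]
      have hy₂ : s₂.wreg 11 = y := by rw [hf₂.w 11 rfl, hf₁.w 11 rfl, hy]
      have hσ₂ : IsCol s₂ σ := fun v => by rw [hf₂.wa 4 rfl, hf₁.wa 4 rfl, hσ]
      have hskip : (⟨j, hj⟩ : Fin n) ∉ B → ∀ s₃ : State, s₃.wreg 13 = s₂.wreg 13 →
          s₃.wreg 14 = s₂.wreg 14 → (s₃.setWReg 20 (j + 1)).wreg 13 = code (below B (j + 1)) σ ∧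
          (s₃.setWReg 20 (j + 1)).wreg 14 = q ^ (below B (j + 1)).card := by
        intro hv s₃ h13 h14
        have hc := below_succ_of_notMem hv
        simp only at hc
        simp [hc, h13, h14, hI]
      refine Tr.ifMem hF hB₂ hx₂ (v := ⟨j, hj⟩) hi (fun hv s₃ hf₃ => ?_)
        (fun hv s₃ hf₃ => Tr.skip_of_pos
          (hskip (by simp [B, hv]) _ (hf₃.w 13 rfl) (hf₃.w 14 rfl)) (by simp))
      have hB₃ := hB₂.of_frame hf₃ (by decide)
      refine Tr.ifMem hF hB₃ (x := y) (by rw [hf₃.w 11 rfl, hy₂]) (v := ⟨j, hj⟩)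
        (by rw [hf₃.w 20 rfl, hi]) (fun hv' s₄ hf₄ => ?_)
        (fun hv' s₄ hf₄ => Tr.skip_of_pos
          (hskip (by simp [B, hv']) _ (by rw [hf₄.w 13 rfl, hf₃.w 13 rfl])
            (by rw [hf₄.w 14 rfl, hf₃.w 14 rfl])) (by simp))
      have hvB : (⟨j, hj⟩ : Fin n) ∈ B := Finset.mem_inter.2 ⟨hv, hv'⟩
      have hb := below_succ_of_mem hvB
      have hcard := card_below_succ_of_mem hvB
      have hcode := code_insert (lt_of_mem_below (B := B) (v := ⟨j, hj⟩)) σ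
      have hp := hpow (j + 1)
      have hlt := (code_lt (below B (j + 1)) σ).trans hp
      simp only at hb hcard hcode
      rw [← hb] at hcode
      rw [hcode] at hlt
      rw [hcard, pow_succ] at hp
      have e13 : s₄.wreg 13 = code (below B j) σ := by rw [hf₄.w 13 rfl, hf₃.w 13 rfl, hI.1]
      have e14 : s₄.wreg 14 = q ^ (below B j).card := by rw [hf₄.w 14 rfl, hf₃.w 14 rfl, hI.2]
      have e4 : s₄.wreg 4 = q := by rw [hf₄.w 4 rfl, hB₃.w4]
      have e20 : s₄.wreg 20 = j := by rw [hf₄.w 20 rfl, hf₃.w 20 rfl, hi]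
      have ea : s₄.warr 4 j = σ ⟨j, hj⟩ := by rw [hf₄.wa 4 rfl, hf₃.wa 4 rfl]; exact hσ₂ ⟨j, hj⟩
      refine Tr.block ?_ ?_
      · simp only [Safes, Instr.Safe, Instr.exec, WordOp.eval, State.setWReg_wreg,
          e20, ea, e14, e13, e4, Nat.reduceEqDiff, if_true, if_false, and_true, true_and]
        exact ⟨by omega, hlt, hp⟩
      · simp [execs, Instr.exec, WordOp.eval, e20, ea, e14, e13, e4, hcode, hcard, pow_succ]
    · intro s₂ _ hI
      rw [hI.1, below_self]
  · have := hF.n_le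
    have := hF.one_le_L
    omega

end

end RAM

/-! ### Enumerating the colorings of a bag -/

namespace RAM

open Coloring

section

variable {n m N : ℕ} {G : Multigraph n m} {q : ℕ} {D : TreeDecomposition G N} {K L W : ℕ}
  {p p₁ p₂ : Program} {T : ℕ} {s s' : State} {Q : State → Prop}

/-- Run `p` for every coloring of the bag of the node `wreg 10`. -/
def forEach (p : Program) : Program := .seq sizeProg (forLoop 23 12 (.seq decode p))

/-- For a variable body the written registers cannot be found by evaluation. This splits off the
fixed part of the program, for which they can. -/
theorem forEach_any (f : Instr → Bool) (p : Program) :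
    (forEach p).any f = ((forEach .skip).any f || p.any f) := by
  simp only [forEach, Program.any, forLoop_any, Bool.or_false]
  cases sizeProg.any f <;> cases f (.wconst 23 0) <;> cases decode.any f <;> cases p.any f <;> simp

theorem forEach_writesW (p : Program) (i : ℕ) :
    (forEach p).writesW i = ((forEach .skip).writesW i || p.writesW i) := forEach_any _ _

theorem forEach_writesWA (p : Program) (r : ℕ) :
    (forEach p).writesWA r = ((forEach .skip).writesWA r || p.writesWA r) := forEach_any _ _

/-- The program may be the body of `forEach`. -/
def Program.Inner (p : Program) : Prop :=
  p.Quiet ∧ ∀ i ∈ [10, 11, 12, 23], p.writesW i = false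

instance (p : Program) : Decidable p.Inner := inferInstanceAs (Decidable (_ ∧ _))

theorem Program.Inner.seq (h₁ : p₁.Inner) (h₂ : p₂.Inner) : (p₁.seq p₂).Inner := by
  have h : ∀ f, p₁.any f = false → p₂.any f = false → (p₁.seq p₂).any f = false := by
    intro f h h'
    simp only [Program.any, h, h', Bool.or_false]
  exact ⟨⟨fun i hi => h _ (h₁.1.1 i hi) (h₂.1.1 i hi), fun i hi => h _ (h₁.1.2 i hi) (h₂.1.2 i hi)⟩,
    fun i hi => h _ (h₁.2 i hi) (h₂.2 i hi)⟩

theorem Program.Inner.forEach_quiet (h : p.Inner) : (forEach p).Quiet := by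
  refine ⟨fun i hi => ?_, fun r hr => ?_⟩
  · rw [forEach_writesW, h.1.1 i hi, Bool.or_false]
    exact (by decide : ∀ i ∈ [0, 1, 2, 3, 4, 5], (forEach .skip).writesW i = false) i hi
  · rw [forEach_writesWA, h.1.2 r hr, Bool.or_false]
    exact (by decide : ∀ i ∈ [0, 1, 2, 3], (forEach .skip).writesWA i = false) r hr

theorem Program.Inner.forEach_ten (h : p.Inner) : (forEach p).writesW 10 = false := by
  rw [forEach_writesW, h.2 10 (by decide)]; rfl

/-- The invariant is indexed by the set of colorings already visited and sees only the numbers, so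
the words used for the enumeration cannot disturb it. There are at most `K` rounds, each costing `T`
plus a multiple of `L` for decoding. -/
theorem Tr.forEach [NeZero q] (hF : Fits q D K L W) (hB : Base q D s) {x : Fin N}
    (hx : s.wreg 10 = x) (hp : p.Inner)
    (I : Finset (Fin n → Fin q) → (ℕ → ℂ) → (ℕ → ℕ → ℂ) → Prop) (h₀ : I ∅ s.nreg s.narr)
    (hstep : ∀ A, ∀ σ ∈ cols q (D.bag x), σ ∉ A → ∀ s', Frame (forEach p) s s' → Base q D s' →
      s'.wreg 10 = x → s'.wreg 23 = code (D.bag x) σ → IsCol s' σ → I A s'.nreg s'.narr →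
      Tr W p T s' fun s'' => I (insert σ A) s''.nreg s''.narr)
    (hQ : ∀ s', Frame (forEach p) s s' → I (cols q (D.bag x)) s'.nreg s'.narr → Q s') :
    Tr W (forEach p) (K * (T + 40 * L)) s Q := by
  have hB10 := hp.2 10 (by decide)
  have hB12 := hp.2 12 (by decide)
  have hB23 := hp.2 23 (by decide)
  set B := D.bag x with hBdef
  refine ((Tr.sizeProg hF hB hx (NeZero.pos q)).seq
    (T₂ := q ^ B.card * ((16 * L + T) + 2) + 2) (Q := Q) fun s₁ hf₁ h12 => ?_).mono ?_
    fun _ _ h => h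
  · have hB₁ := hB.of_frame hf₁ (by decide)
    have hF₁ : Frame (RAM.forEach p) s s₁ := hf₁.mono fun f h => by
      simp only [RAM.forEach, Program.any, Bool.or_eq_false_iff] at h; exact h.1
    have hF₂ : ∀ {s₂}, Frame (RAM.forLoop 23 12 (.seq RAM.decode p)) s₁ s₂ → Frame (RAM.forEach p) s s₂ :=
      fun hf₂ => hF₁.trans (hf₂.mono fun f h => by
        rw [RAM.forEach, Program.any, Bool.or_eq_false_iff] at h; exact h.2)
    have hn₁ : s₁.nreg = s.nreg := funext fun i => hf₁.n i rfl
    have hna₁ : s₁.narr = s.narr := funext fun i => hf₁.na i rfl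
    -- Round `j` visits the coloring with code `j`; those visited before have smaller codes.
    refine Tr.forLoop (fun j s => I ((cols q B).filter fun σ => code B σ < j) s.nreg s.narr)
      h12 hB₁.w3 (by decide) (by decide) ?_ ?_ ?_ ?_
    · refine ⟨?_, ?_, ?_⟩
      · exact hB23
      · exact hB12
      · exact hp.1.1 3 (by decide)
    · simpa [hn₁, hna₁] using h₀
    · intro j hj s₂ hf₂ hi hI
      obtain ⟨σ, hσ, hc⟩ := exists_code_eq hj
      have hB₂ := hB.of_frame (hF₂ hf₂) hp.forEach_quiet
      have hx₂ : s₂.wreg 10 = x := by rw [(hF₂ hf₂).w 10 hp.forEach_ten, hx]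
      refine (Tr.decode hF hB₂ hx₂ hσ (hi.trans hc.symm)).seq fun s₃ hf₃ hσ₃ => ?_
      have hF₃ : Frame (RAM.forEach p) s s₃ := (hF₂ hf₂).trans (hf₃.mono fun f h => by
        simp only [RAM.forEach, Program.any, Bool.or_eq_false_iff, forLoop_any] at h
        exact h.2.2.1.1)
      have hn₃ : s₃.nreg = s₂.nreg := funext fun i => hf₃.n i rfl
      have hna₃ : s₃.narr = s₂.narr := funext fun i => hf₃.na i rfl
      have hins : (cols q B).filter (fun σ => code B σ < j + 1) =
          insert σ ((cols q B).filter fun σ => code B σ < j) := by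
        ext τ
        simp only [Finset.mem_filter, Finset.mem_insert]
        constructor
        · rintro ⟨hτ, h⟩
          by_cases e : code B τ = j
          · exact .inl (eq_of_code_eq hτ hσ (e.trans hc.symm))
          · exact .inr ⟨hτ, by omega⟩
        · rintro (rfl | ⟨hτ, h⟩)
          · exact ⟨hσ, by omega⟩
          · exact ⟨hτ, by omega⟩
      simp only [hins, State.setWReg_nreg, State.setWReg_narr]
      refine hstep _ σ hσ (by simp [hc]) s₃ hF₃ (hB₂.of_frame hf₃ (by decide)) ?_ ?_ hσ₃ ?_
      · rw [hf₃.w 10 rfl, hx₂]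
      · rw [hf₃.w 23 rfl, hi, hc]
      · rw [hn₃, hna₃]; exact hI
    · intro s₂ hf₂ hI
      refine hQ s₂ (hF₂ hf₂) ?_
      rwa [Finset.filter_true_of_mem fun σ _ => code_lt B σ] at hI
  · have h₁ : q ^ B.card * ((16 * L + T) + 2) ≤ K * ((16 * L + T) + 2) :=
      Nat.mul_le_mul_right _ (hF.pow_le x)
    have hL := hF.one_le_L
    have h₂ : L ≤ K * L := Nat.le_mul_of_pos_left _ hF.one_le_K
    have h₃ : K ≤ K * L := Nat.le_mul_of_pos_right _ hL
    nlinarith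

/-! ### Tables -/

/-- The position in the number array `0` of the entry for the node `x` and the coloring `σ`. -/
def idx (D : TreeDecomposition G N) (x : Fin N) (σ : Fin n → Fin q) : ℕ :=
  code (D.bag x) σ * N + x

/-- The tables are interleaved: the address modulo `N` is the node and the quotient is the code.
Tables of different sizes thus share one array without offsets. -/
theorem idx_inj {x y : Fin N} {σ τ : Fin n → Fin q} (h : idx D x σ = idx D y τ) :
    x = y ∧ ∀ v ∈ D.bag x, σ v = τ v := by
  obtain ⟨h₁, h₂⟩ := mul_add_inj x.2 y.2 h
  obtain rfl : x = y := Fin.ext h₂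
  exact ⟨rfl, code_inj h₁⟩

theorem idx_congr {x : Fin N} {σ τ : Fin n → Fin q} (h : ∀ v ∈ D.bag x, σ v = τ v) :
    idx D x σ = idx D x τ := by
  rw [idx, code_congr h, idx]

theorem idx_eq_iff [NeZero q] {x y : Fin N} {σ τ : Fin n → Fin q} (hσ : σ ∈ cols q (D.bag x)) :
    idx D y τ = idx D x σ ↔ y = x ∧ restrict (D.bag x) τ = σ := by
  constructor
  · intro h
    obtain ⟨rfl, h'⟩ := idx_inj h
    refine ⟨rfl, funext fun v => ?_⟩
    by_cases hv : v ∈ D.bag y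
    · rw [restrict_of_mem _ hv, h' v hv]
    · rw [restrict, if_neg hv, mem_cols.1 hσ v hv]
  · rintro ⟨rfl, rfl⟩
    exact (idx_congr fun v hv => restrict_of_mem _ hv).symm

theorem Fits.idx_lt (hF : Fits q D K L W) (x : Fin N) (σ : Fin n → Fin q) : idx D x σ < W :=
  (mul_add_lt (code_lt _ _) x.2).trans (hF.pow_lt x)

theorem Fits.code_mul_lt (hF : Fits q D K L W) (x : Fin N) (σ : Fin n → Fin q) :
    code (D.bag x) σ * N < W := (Nat.le_add_right _ _).trans_lt (hF.idx_lt x σ)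

/-- Multiply the entry of the table of the node `wreg 10` for each coloring by the number that `p`
leaves in the number register `21`. -/
def mulTable (p : Program) : Program :=
  forEach (.seq p (block [.wop .mul 26 23 2, .wop .add 26 26 10, .nload 20 0 26, .nop .mul 20 20 21,
    .nstore 0 26 20]))

theorem Tr.mulTable [NeZero q] (hF : Fits q D K L W) (hB : Base q D s) {x : Fin N}
    (hx : s.wreg 10 = x) (hp : p.Inner) (hp0 : p.writesNA 0 = false)
    (H : (Fin n → Fin q) → ℂ)
    (hH : ∀ σ ∈ cols q (D.bag x), ∀ s', Frame (mulTable p) s s' → Base q D s' → s'.wreg 10 = x →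
      IsCol s' σ → Tr W p T s' fun s'' => s''.nreg 21 = H σ)
    (hQ : ∀ s', Frame (mulTable p) s s' → (∀ (y : Fin N) (τ : Fin n → Fin q),
      s'.narr 0 (idx D y τ) =
        s.narr 0 (idx D y τ) * if y = x then H (restrict (D.bag x) τ) else 1) → Q s') :
    Tr W (mulTable p) (K * (T + 6 + 40 * L)) s Q := by
  -- Entries of visited colorings carry their factor, all others are untouched; `σ ∉ A` ensures that
  -- no entry is multiplied twice.
  refine Tr.forEach hF hB hx ?_ (fun A _ na => ∀ (y : Fin N) (τ : Fin n → Fin q),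
    na 0 (idx D y τ) = s.narr 0 (idx D y τ) *
      if y = x ∧ restrict (D.bag x) τ ∈ A then H (restrict (D.bag x) τ) else 1) (by simp) ?_ ?_
  · exact hp.seq (by decide)
  · intro A σ hσ hσA s₁ hf₁ hB₁ hx₁ hc₁ hσ₁ hI
    refine (hH σ hσ s₁ hf₁ hB₁ hx₁ hσ₁).seq fun s₂ hf₂ h21 => ?_
    have e23 : s₂.wreg 23 = code (D.bag x) σ := by rw [hf₂.w 23 (hp.2 23 (by decide)), hc₁]
    have e10 : s₂.wreg 10 = x := by rw [hf₂.w 10 (hp.2 10 (by decide)), hx₁]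
    have e2 := (hB₁.of_frame hf₂ hp.1).w2
    have hi := hF.idx_lt x σ
    have hc := hF.code_mul_lt x σ
    rw [idx] at hi
    refine Tr.block ?_ ?_
    · simp [Safes, Instr.Safe, Instr.exec, WordOp.eval, e23, e10, e2, hi, hc]
    · intro y τ
      simp only [execs, Instr.exec, WordOp.eval, NumOp.eval, State.setWReg_wreg, e23, e10, e2, h21,
        Nat.reduceEqDiff, if_true, if_false, State.setNReg_wreg, State.setNReg_nreg,
        State.setNArr_narr, State.setNReg_narr, State.setWReg_narr, State.setWReg_nreg, true_and]
      simp only [show code (D.bag x) σ * N + x = idx D x σ from rfl, idx_eq_iff hσ, hf₂.na 0 hp0, hI x σ, hI y τ]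
      by_cases h : y = x ∧ restrict (D.bag x) τ = σ
      · obtain ⟨rfl, rfl⟩ := h
        have e : idx D y (restrict (D.bag y) τ) = idx D y τ :=
          idx_congr fun v hv => restrict_of_mem _ hv
        have e' : restrict (D.bag y) (restrict (D.bag y) τ) = restrict (D.bag y) τ := by
          funext v; by_cases hv : v ∈ D.bag y <;> simp [restrict, hv]
        simp [e, e', hσA]
      · rw [if_neg h]
        have : (y = x ∧ restrict (D.bag x) τ ∈ insert σ A) ↔
            (y = x ∧ restrict (D.bag x) τ ∈ A) := by
          rw [Finset.mem_insert]; tauto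
        simp only [this]
  · intro s₁ hf₁ hI
    refine hQ s₁ hf₁ fun y τ => ?_
    rw [hI y τ]
    simp [restrict_mem_cols]

end

end RAM

namespace RAM

open Coloring

section

variable {n m N : ℕ} {G : Multigraph n m} {q : ℕ} {D : TreeDecomposition G N} {K L W : ℕ}
  {p p₁ p₂ : Program} {T : ℕ} {s s' : State} {Q : State → Prop}

/-! ### Initialization -/

/-- Fill the tables with `nreg 3`, and mark all nodes in the word array `5` as alive. -/
def initTables : Program :=
  forLoop 10 2 (.seq (block [.wstore 5 10 3])
    (forEach (block [.wop .mul 26 23 2, .wop .add 26 26 10, .nstore 0 26 3])))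

theorem Tr.initTables [NeZero q] (hF : Fits q D K L W) (hB : Base q D s) (h3 : s.nreg 3 = 1) :
    Tr W initTables (50 * K * L ^ 2) s fun s' => ∀ x : Fin N, s'.warr 5 x = 1 ∧
      ∀ τ : Fin n → Fin q, s'.narr 0 (idx D x τ) = 1 := by
  refine (Tr.forLoop (T := 2 + K * (4 + 40 * L)) (fun j s => ∀ x : Fin N, (x : ℕ) < j →
    s.warr 5 x = 1 ∧ ∀ τ : Fin n → Fin q, s.narr 0 (idx D x τ) = 1) hB.w2 hB.w3 (by decide)
    (by decide) ⟨rfl, rfl, rfl⟩ (by simp) (fun j hj s₁ hf₁ h10 hI => ?_)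
    fun s₁ _ hI x => hI x x.2).mono ?_ fun _ _ h => h
  · have hB₁ := hB.of_frame hf₁ (by decide)
    have h3₁ : s₁.nreg 3 = 1 := (hf₁.n 3 rfl).trans h3
    have h₂ : Tr W (RAM.block [.wstore 5 10 3]) 2 s₁ fun s₂ =>
        s₂.warr 5 j = 1 ∧ ∀ x ≠ j, s₂.warr 5 x = s₁.warr 5 x :=
      Tr.block (by simp [Safes, Instr.Safe])
        (by simp +contextual [execs, Instr.exec, h10, hB₁.w3])
    refine h₂.seq fun s₂ hf₂ hs₂ => ?_
    have hB₂ := hB₁.of_frame hf₂ (by decide)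
    let x : Fin N := ⟨j, hj⟩
    refine Tr.forEach hF hB₂ (x := x) (by rw [hf₂.w 10 rfl, h10]) (by decide)
      (fun A _ na => ∀ (y : Fin N) (τ : Fin n → Fin q), na 0 (idx D y τ) =
        if y = x ∧ restrict (D.bag x) τ ∈ A then 1 else s₁.narr 0 (idx D y τ)) ?_ ?_ ?_
    · simp [hf₂.na 0 rfl]
    · intro A σ hσ hσA s₃ hf₃ hB₃ hx₃ hc₃ hσ₃ hI₃
      have h3₃ : s₃.nreg 3 = 1 := by rw [hf₃.n 3 rfl, hf₂.n 3 rfl, h3₁]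
      have hi := hF.idx_lt x σ
      have hc := hF.code_mul_lt x σ
      rw [idx] at hi
      refine Tr.block ?_ ?_
      · simp [Safes, Instr.Safe, Instr.exec, WordOp.eval, hc₃, hx₃, hB₃.w2, hi, hc]
      · intro y τ
        simp only [execs, Instr.exec, WordOp.eval, State.setWReg_wreg, hc₃, hx₃, hB₃.w2,
          Nat.reduceEqDiff, if_true, if_false, State.setNArr_narr, State.setWReg_narr,
          State.setWReg_nreg, true_and, show code (D.bag x) σ * N + x = idx D x σ from rfl,
          idx_eq_iff hσ, h3₃, hI₃ y τ]
        by_cases h : y = x ∧ restrict (D.bag x) τ = σ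
        · rw [if_pos h, if_pos ⟨h.1, by simp [h.2]⟩]
        · have : (y = x ∧ restrict (D.bag x) τ ∈ insert σ A) ↔
              (y = x ∧ restrict (D.bag x) τ ∈ A) := by
            rw [Finset.mem_insert]; tauto
          simp only [if_neg h, this]
    · intro s₃ hf₃ hI₃ y hy
      have h5 : s₃.warr 5 = s₂.warr 5 := hf₃.wa 5 rfl
      simp only [State.setWReg_warr, State.setWReg_narr, h5, hI₃]
      by_cases h : y = x
      · subst h
        exact ⟨hs₂.1, fun τ => by simp [restrict_mem_cols]⟩
      · have hyj : (y : ℕ) ≠ j := fun e => h (Fin.ext e)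
        have := hI y (by omega)
        exact ⟨by rw [hs₂.2 y hyj, this.1], fun τ => by rw [if_neg (fun h' => h h'.1), this.2]⟩
  · have hN := hF.N_le
    have hL := hF.one_le_L
    have hK := hF.one_le_K
    have h₁ : L ≤ K * L := Nat.le_mul_of_pos_left _ hK
    have h₂ : K ≤ K * L := Nat.le_mul_of_pos_right _ hL
    have h₃ : K * L ≤ K * L ^ 2 := by rw [pow_two, ← mul_assoc]; exact Nat.le_mul_of_pos_right _ hL
    calc N * (2 + K * (4 + 40 * L) + 2) + 2 ≤ L * (2 + K * (4 + 40 * L) + 2) + 2 := by gcongr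
      _ ≤ 50 * K * L ^ 2 := by nlinarith

/-! ### The edges -/

/-- `wreg 10` becomes a node whose bag contains the vertices `wreg 31` and `wreg 32`. -/
def findBag : Program :=
  forLoop 33 2 (.seq (block [.wop .mul 21 33 0, .wop .add 22 21 31, .wload 22 3 22,
    .wop .add 21 21 32, .wload 21 3 21, .wop .mul 21 21 22])
    (.ite (.weq 21 3) (block [.wop .add 10 33 5]) .skip))

theorem Tr.findBag (hF : Fits q D K L W) (hB : Base q D s) {u v : Fin n} (hu : s.wreg 31 = u)
    (hv : s.wreg 32 = v) (huv : ∃ x, u ∈ D.bag x ∧ v ∈ D.bag x) :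
    Tr W findBag (15 * L) s fun s' => ∃ x : Fin N, s'.wreg 10 = x ∧ u ∈ D.bag x ∧ v ∈ D.bag x := by
  -- The invariant is conditional because register 10 is arbitrary until a suitable node has been
  -- met. Later hits may overwrite earlier ones.
  refine (Tr.forLoop (T := 7 + (2 + 1)) (fun j s =>
    (∃ x : Fin N, (x : ℕ) < j ∧ u ∈ D.bag x ∧ v ∈ D.bag x) →
      ∃ x : Fin N, s.wreg 10 = x ∧ u ∈ D.bag x ∧ v ∈ D.bag x) hB.w2 hB.w3 (by decide)
    (by decide) ⟨rfl, rfl, rfl⟩ (by simp) (fun j hj s₁ hf₁ h33 hI => ?_) ?_).mono ?_ fun _ _ h => h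
  · have hB₁ := hB.of_frame hf₁ (by decide)
    have hu₁ : s₁.wreg 31 = u := (hf₁.w 31 rfl).trans hu
    have hv₁ : s₁.wreg 32 = v := (hf₁.w 32 rfl).trans hv
    let x : Fin N := ⟨j, hj⟩
    have hxu : (j : ℕ) * n + u < W := (mul_add_lt hj u.2).trans hF.Nn_lt
    have hxv : (j : ℕ) * n + v < W := (mul_add_lt hj v.2).trans hF.Nn_lt
    have hmu := hB₁.mem x u
    have hmv := hB₁.mem x v
    have hlu := hB₁.mem_le x u
    have hlv := hB₁.mem_le x v
    simp only [x] at hmu hmv hlu hlv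
    have h₂ : Tr W (RAM.block [.wop .mul 21 33 0, .wop .add 22 21 31, .wload 22 3 22,
        .wop .add 21 21 32, .wload 21 3 21, .wop .mul 21 21 22]) 7 s₁ fun s₂ =>
        s₂.wreg 21 = 1 ↔ u ∈ D.bag x ∧ v ∈ D.bag x := by
      refine Tr.block ?_ ?_
      · simp [Safes, Instr.Safe, Instr.exec, WordOp.eval, h33, hB₁.w0, hu₁, hv₁, hxu, hxv]
        exact ⟨by omega, (Nat.mul_le_mul hlv hlu).trans_lt (by simpa using hF.one_lt)⟩
      · simp [execs, Instr.exec, WordOp.eval, h33, hB₁.w0, hu₁, hv₁, hmu, hmv, and_comm, x]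
    refine h₂.seq fun s₂ hf₂ hs₂ => ?_
    have hB₂ := hB₁.of_frame hf₂ (by decide)
    refine Tr.ite (fun hb => ?_) (fun hb => ?_)
    · have hb' := hs₂.1 (by simpa [Test.holds, hB₂.w3] using hb)
      have e : s₂.wreg 33 = j := (hf₂.w 33 rfl).trans h33
      refine Tr.block ?_ ?_
      · simp only [Safes, Instr.Safe, WordOp.eval, e, hB₂.w5, add_zero, and_true]
        exact hj.trans (hF.N_le.trans_lt hF.L_lt)
      · exact fun _ => ⟨x, by simp [execs, Instr.exec, WordOp.eval, e, hB₂.w5, x], hb'⟩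
    · have hb' : ¬ (u ∈ D.bag x ∧ v ∈ D.bag x) := fun h => hb (by
        simpa [Test.holds, hB₂.w3] using hs₂.2 h)
      refine Tr.skip_of_pos ?_ (by decide)
      rintro ⟨y, hy, h⟩
      have hyx : (y : ℕ) ≠ j := fun e => hb' (by obtain rfl : y = x := Fin.ext e; exact h)
      obtain ⟨z, hz, h⟩ := hI ⟨y, by omega, h⟩
      exact ⟨z, by simpa [hf₂.w 10 rfl] using hz, h⟩
  · intro s₁ _ hI
    obtain ⟨x, hx⟩ := huv
    exact hI ⟨x, x.2, hx⟩
  · have hN := hF.N_le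
    have hL := hF.one_le_L
    omega

/-- The weight of the edge with ends `wreg 31` and `wreg 32`. -/
def edgeWeight : Program :=
  .seq (block [.wload 25 4 31, .wload 26 4 32])
    (.ite (.weq 25 26) (block [.nop .add 21 10 4]) (block [.nop .add 21 11 4]))

/-- Multiply the tables by the weights of the edges. -/
def edges : Program :=
  forLoop 30 1 (.seq (block [.wload 31 0 30, .wload 32 1 30]) (.seq findBag (mulTable edgeWeight)))

/-- Only the product of all tables is tracked, so it is irrelevant which suitable node receives an
edge, as long as exactly one does. -/
theorem Tr.edges [NeZero q] (hF : Fits q D K L W) (hB : Base q D s) {w₁ w₂ : ℂ}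
    (h4 : s.nreg 4 = 0) (h10 : s.nreg 10 = w₁) (h11 : s.nreg 11 = w₂)
    (h₀ : ∀ (x : Fin N) (τ : Fin n → Fin q), s.narr 0 (idx D x τ) = 1) :
    Tr W edges (100 * K * L ^ 2) s fun s' => ∀ τ : Fin n → Fin q,
      ∏ x, s'.narr 0 (idx D x τ) = ∏ e, if τ (G.ends e).1 = τ (G.ends e).2 then w₁ else w₂ := by
  refine (Tr.forLoop (T := 3 + (15 * L + K * ((3 + (2 + 1)) + 6 + 40 * L))) (fun j s =>
    ∀ τ : Fin n → Fin q, ∏ x, s.narr 0 (idx D x τ) =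
      ∏ e ∈ below Finset.univ j, if τ (G.ends e).1 = τ (G.ends e).2 then w₁ else w₂)
    hB.w1 hB.w3 (by decide)
    (by decide) ⟨rfl, rfl, rfl⟩ (by simp [below_zero, h₀]) (fun j hj s₁ hf₁ h30 hI => ?_) ?_).mono
    ?_ fun _ _ h => h
  · have hB₁ := hB.of_frame hf₁ (by decide)
    let e : Fin m := ⟨j, hj⟩
    have h₂ : Tr W (RAM.block [.wload 31 0 30, .wload 32 1 30]) 3 s₁ fun s₂ =>
        s₂.wreg 31 = (G.ends e).1 ∧ s₂.wreg 32 = (G.ends e).2 := by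
      have e₁ := hB₁.ends₁ e
      have e₂ := hB₁.ends₂ e
      refine Tr.block (by simp [Safes, Instr.Safe]) ?_
      simpa [execs, Instr.exec, h30] using ⟨e₁, e₂⟩
    refine h₂.seq fun s₂ hf₂ hs₂ => ?_
    have hB₂ := hB₁.of_frame hf₂ (by decide)
    refine (Tr.findBag hF hB₂ hs₂.1 hs₂.2 (D.edge_covered e)).seq fun s₃ hf₃ hs₃ => ?_
    obtain ⟨x, hx, hx₁, hx₂⟩ := hs₃
    have hB₃ := hB₂.of_frame hf₃ (by decide)
    refine Tr.mulTable hF hB₃ hx (by decide) rfl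
      (fun σ => if σ (G.ends e).1 = σ (G.ends e).2 then w₁ else w₂) ?_ ?_
    · intro σ hσ s₄ hf₄ hB₄ hx₄ hσ₄
      have h31 : s₄.wreg 31 = (G.ends e).1 := by rw [hf₄.w 31 rfl, hf₃.w 31 rfl, hs₂.1]
      have h32 : s₄.wreg 32 = (G.ends e).2 := by rw [hf₄.w 32 rfl, hf₃.w 32 rfl, hs₂.2]
      have h₅ : Tr W (RAM.block [.wload 25 4 31, .wload 26 4 32]) 3 s₄ fun s₅ =>
          s₅.wreg 25 = σ (G.ends e).1 ∧ s₅.wreg 26 = σ (G.ends e).2 := by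
        have e₁ := hσ₄ (G.ends e).1
        have e₂ := hσ₄ (G.ends e).2
        refine Tr.block (by simp [Safes, Instr.Safe]) ?_
        simpa [execs, Instr.exec, h31, h32] using ⟨e₁, e₂⟩
      refine h₅.seq fun s₅ hf₅ hs₅ => ?_
      have k4 : s₅.nreg 4 = 0 := by
        rw [hf₅.n 4 rfl, hf₄.n 4 rfl, hf₃.n 4 rfl, hf₂.n 4 rfl, hf₁.n 4 rfl, h4]
      have k10 : s₅.nreg 10 = w₁ := by
        rw [hf₅.n 10 rfl, hf₄.n 10 rfl, hf₃.n 10 rfl, hf₂.n 10 rfl, hf₁.n 10 rfl, h10]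
      have k11 : s₅.nreg 11 = w₂ := by
        rw [hf₅.n 11 rfl, hf₄.n 11 rfl, hf₃.n 11 rfl, hf₂.n 11 rfl, hf₁.n 11 rfl, h11]
      have hiff : (Test.weq 25 26).holds s₅ ↔ σ (G.ends e).1 = σ (G.ends e).2 := by
        rw [Test.holds, hs₅.1, hs₅.2, Fin.ext_iff]
      refine Tr.ite (fun hb => Tr.block (by simp [Safes, Instr.Safe]) ?_)
        (fun hb => Tr.block (by simp [Safes, Instr.Safe]) ?_)
      · simp [execs, Instr.exec, NumOp.eval, k4, k10, hiff.1 hb]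
      · simp [execs, Instr.exec, NumOp.eval, k4, k11, mt hiff.2 hb]
    · intro s₄ hf₄ hs₄ τ
      have hb := below_succ_of_mem (Finset.mem_univ e)
      simp only [e] at hb
      have hna : s₃.narr 0 = s₁.narr 0 := by rw [hf₃.na 0 rfl, hf₂.na 0 rfl]
      simp only [State.setWReg_narr, hs₄, hna, Finset.prod_mul_distrib, hI]
      rw [hb, Finset.prod_insert fun h => (lt_of_mem_below _ h).false, mul_comm]
      simp [restrict_of_mem _ hx₁, restrict_of_mem _ hx₂, e]
  · intro s₁ _ hI τ
    rw [hI τ, below_self]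
  · have hm := hF.m_le
    have hL := hF.one_le_L
    have hK := hF.one_le_K
    have h₁ : L ≤ K * L := Nat.le_mul_of_pos_left _ hK
    have h₂ : K ≤ K * L := Nat.le_mul_of_pos_right _ hL
    have h₃ : K * L ≤ K * L ^ 2 := by rw [pow_two, ← mul_assoc]; exact Nat.le_mul_of_pos_right _ hL
    have h₄ : L * L ≤ K * L ^ 2 := by rw [pow_two]; exact Nat.le_mul_of_pos_left _ hK
    calc m * (3 + (15 * L + K * ((3 + (2 + 1)) + 6 + 40 * L)) + 2) + 2
        ≤ L * (3 + (15 * L + K * ((3 + (2 + 1)) + 6 + 40 * L)) + 2) + 2 := by gcongr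
      _ ≤ 100 * K * L ^ 2 := by nlinarith

/-! ### Finding a leaf -/

/-- The word array `5` marks the nodes in `S`. -/
def Alive (s : State) (S : Finset (Fin N)) : Prop :=
  ∀ x : Fin N, s.warr 5 x = if x ∈ S then 1 else 0

/-- `wreg 34` counts the alive neighbors of the node `wreg 33`, and `wreg 36` is the last of them. -/
def countNeighbors : Program :=
  .seq (block [.wconst 34 0]) (forLoop 35 2 (.seq
    (block [.wop .mul 21 33 2, .wop .add 21 21 35, .wload 21 2 21, .wload 22 5 35,
      .wop .mul 21 21 22])
    (.ite (.weq 21 3) (block [.wop .add 34 34 3, .wop .add 36 35 5]) .skip)))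

open Classical in
theorem Tr.countNeighbors (hF : Fits q D K L W) (hB : Base q D s) {S : Finset (Fin N)}
    (hS : Alive s S) {x : Fin N} (hx : s.wreg 33 = x) :
    Tr W countNeighbors (16 * L) s fun s' => s'.wreg 34 = (S.filter (D.tree.Adj x)).card ∧
      ((S.filter (D.tree.Adj x)).Nonempty → ∃ y ∈ S.filter (D.tree.Adj x), s'.wreg 36 = y) := by
  set A := S.filter (D.tree.Adj x) with hA
  have h₁ : Tr W (RAM.block [.wconst 34 0]) 2 s fun s' => s'.wreg 34 = 0 :=
    Tr.block (by simpa [Safes, Instr.Safe] using (Nat.zero_le _).trans_lt hF.one_lt)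
      (by simp [execs, Instr.exec])
  refine (h₁.seq (T₂ := N * (6 + (3 + 1) + 2) + 2) fun s₁ hf₁ hs₁ => ?_).mono ?_ fun _ _ h => h
  · have hB₁ := hB.of_frame hf₁ (by decide)
    refine Tr.forLoop (fun j s => s.wreg 34 = (below A j).card ∧
      ((below A j).Nonempty → ∃ y ∈ A, s.wreg 36 = (y : Fin N))) hB₁.w2 hB₁.w3 (by decide)
      (by decide) ⟨rfl, rfl, rfl⟩ (by simp [below_zero, hs₁]) (fun j hj s₂ hf₂ h35 hI => ?_) ?_
    · have hB₂ := hB₁.of_frame hf₂ (by decide)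
      let y : Fin N := ⟨j, hj⟩
      have hx₂ : s₂.wreg 33 = x := by rw [hf₂.w 33 rfl, hf₁.w 33 rfl, hx]
      have hS₂ : s₂.warr 5 j = if y ∈ S then 1 else 0 := by
        rw [hf₂.wa 5 rfl, hf₁.wa 5 rfl]; exact hS y
      have hxy : (x : ℕ) * N + j < W := (mul_add_lt x.2 hj).trans hF.NN_lt
      have hadj := hB₂.adj x y
      have hle := hB₂.adj_le x y
      simp only [y] at hadj hle
      have h₃ : Tr W (RAM.block [.wop .mul 21 33 2, .wop .add 21 21 35, .wload 21 2 21,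
          .wload 22 5 35, .wop .mul 21 21 22]) 6 s₂ fun s₃ => s₃.wreg 21 = 1 ↔ y ∈ A := by
        refine Tr.block ?_ ?_
        · simp only [Safes, Instr.Safe, Instr.exec, WordOp.eval, State.setWReg_wreg, hx₂, hB₂.w2,
            h35, State.setWReg_warr, Nat.reduceEqDiff, if_true, if_false, hS₂, and_true, true_and]
          refine ⟨by omega, hxy, ?_⟩
          split_ifs
          · rw [mul_one]; exact hle.trans_lt hF.one_lt
          · rw [mul_zero]; exact (Nat.zero_le _).trans_lt hF.one_lt
        · simp only [execs, Instr.exec, WordOp.eval, State.setWReg_wreg, hx₂, hB₂.w2,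
            h35, State.setWReg_warr, Nat.reduceEqDiff, if_true, if_false, hS₂, hA,
            Finset.mem_filter]
          by_cases h : y ∈ S <;> simp [h, hadj, y]
      refine h₃.seq fun s₃ hf₃ hs₃ => ?_
      have hB₃ := hB₂.of_frame hf₃ (by decide)
      have e34 : s₃.wreg 34 = (below A j).card := by rw [hf₃.w 34 rfl, hI.1]
      have e35 : s₃.wreg 35 = j := by rw [hf₃.w 35 rfl, h35]
      refine Tr.ite (fun hb => ?_) (fun hb => ?_)
      · have hy : y ∈ A := hs₃.1 (by simpa [Test.holds, hB₃.w3] using hb)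
        have hc := card_below_succ_of_mem hy
        have hcle := (card_below_le A (j + 1)).trans (Finset.card_le_univ A)
        have hNW : N < W := hF.N_le.trans_lt hF.L_lt
        rw [Fintype.card_fin] at hcle
        simp only [y] at hc
        refine Tr.block ?_ ?_
        · simp [Safes, Instr.Safe, Instr.exec, WordOp.eval, e34, e35, hB₃.w3, hB₃.w5]
          omega
        · refine ⟨by simp [execs, Instr.exec, WordOp.eval, e34, hB₃.w3, hc], fun _ => ⟨y, hy, ?_⟩⟩
          simp [execs, Instr.exec, WordOp.eval, e35, hB₃.w5, y]
      · have hy : y ∉ A := fun h => hb (by simpa [Test.holds, hB₃.w3] using hs₃.2 h)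
        have hc := below_succ_of_notMem hy
        simp only [y] at hc
        refine Tr.skip_of_pos ?_ (by decide)
        simpa [hc, e34, hf₃.w 36 rfl] using hI.2
    · intro s₂ _ hI
      rwa [below_self] at hI
  · have hN := hF.N_le
    have hL := hF.one_le_L
    omega

/-- `wreg 10` becomes an alive node with exactly one alive neighbor, and `wreg 11` becomes this
neighbor. -/
def findLeaf : Program :=
  forLoop 33 2 (.seq countNeighbors (.seq (block [.wload 21 5 33, .wop .mul 21 21 34])
    (.ite (.weq 21 3) (block [.wop .add 10 33 5, .wop .add 11 36 5]) .skip)))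

theorem Tr.findLeaf (hF : Fits q D K L W) (hB : Base q D s) {S : Finset (Fin N)}
    (hS : Alive s S) (hleaf : ∃ x p, D.tree.IsLeafAt S x p) :
    Tr W findLeaf (30 * L ^ 2) s fun s' => ∃ x p : Fin N, D.tree.IsLeafAt S x p ∧
      s'.wreg 10 = x ∧ s'.wreg 11 = p := by
  classical
  refine (Tr.forLoop (T := 16 * L + (3 + (3 + 1))) (fun j s =>
    (∃ x p : Fin N, (x : ℕ) < j ∧ D.tree.IsLeafAt S x p) →
      ∃ x p : Fin N, D.tree.IsLeafAt S x p ∧ s.wreg 10 = x ∧ s.wreg 11 = p) hB.w2 hB.w3 (by decide)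
    (by decide) ⟨rfl, rfl, rfl⟩ (by simp) (fun j hj s₁ hf₁ h33 hI => ?_) ?_).mono ?_ fun _ _ h => h
  · have hB₁ := hB.of_frame hf₁ (by decide)
    let x : Fin N := ⟨j, hj⟩
    have hS₁ : Alive s₁ S := fun y => by rw [hf₁.wa 5 rfl, hS]
    refine (Tr.countNeighbors hF hB₁ hS₁ (x := x) h33).seq fun s₂ hf₂ hs₂ => ?_
    have hB₂ := hB₁.of_frame hf₂ (by decide)
    have e33 : s₂.wreg 33 = j := by rw [hf₂.w 33 rfl, h33]
    have e5 : s₂.warr 5 j = if x ∈ S then 1 else 0 := by rw [hf₂.wa 5 rfl]; exact hS₁ x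
    set A := S.filter (D.tree.Adj x) with hA
    have hNW : N < W := hF.N_le.trans_lt hF.L_lt
    have hAW : A.card < W := (Finset.card_le_univ A).trans_lt (by simpa using hNW)
    -- Multiplying the alive bit by the number of alive neighbors gives 1 only for an alive node
    -- with exactly one of them.
    have h₃ : Tr W (RAM.block [.wload 21 5 33, .wop .mul 21 21 34]) 3 s₂ fun s₃ =>
        s₃.wreg 21 = 1 ↔ x ∈ S ∧ A.card = 1 := by
      refine Tr.block ?_ ?_
      · simp only [Safes, Instr.Safe, Instr.exec, WordOp.eval, State.setWReg_wreg, e33, e5, hs₂.1,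
          Nat.reduceEqDiff, if_true, if_false, and_true, true_and]
        split_ifs
        · rwa [one_mul]
        · rw [zero_mul]; exact (Nat.zero_le _).trans_lt hNW
      · simp only [execs, Instr.exec, WordOp.eval, State.setWReg_wreg, e33, e5, hs₂.1,
          Nat.reduceEqDiff, if_true, if_false]
        by_cases h : x ∈ S <;> simp [h]
    refine h₃.seq fun s₃ hf₃ hs₃ => ?_
    have hB₃ := hB₂.of_frame hf₃ (by decide)
    refine Tr.ite (fun hb => ?_) (fun hb => ?_)
    · obtain ⟨hxS, hcard⟩ := hs₃.1 (by simpa [Test.holds, hB₃.w3] using hb)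
      obtain ⟨y, hyA, hy⟩ := hs₂.2 (Finset.card_pos.1 (by omega))
      have hyA' := Finset.mem_filter.1 hyA
      have e33' : s₃.wreg 33 = j := by rw [hf₃.w 33 rfl, e33]
      have e36 : s₃.wreg 36 = y := by rw [hf₃.w 36 rfl, hy]
      refine Tr.block ?_ ?_
      · simp [Safes, Instr.Safe, Instr.exec, WordOp.eval, e33', e36, hB₃.w5]
        exact ⟨hj.trans hNW, y.2.trans hNW⟩
      · refine fun _ => ⟨x, y, ⟨hxS, hyA'.1, hyA'.2, fun z hz hadj => ?_⟩, ?_, ?_⟩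
        · exact Finset.card_le_one.1 hcard.le z (Finset.mem_filter.2 ⟨hz, hadj⟩) y hyA
        · simp [execs, Instr.exec, WordOp.eval, e33', hB₃.w5, x]
        · simp [execs, Instr.exec, WordOp.eval, e36, hB₃.w5]
    · have hb' : ¬ (x ∈ S ∧ A.card = 1) := fun h => hb (by
        simpa [Test.holds, hB₃.w3] using hs₃.2 h)
      refine Tr.skip_of_pos ?_ (by decide)
      rintro ⟨y, p, hy, h⟩
      have hyx : (y : ℕ) ≠ j := by
        intro e
        obtain rfl : y = x := Fin.ext e
        refine hb' ⟨h.1, Finset.card_eq_one.2 ⟨p, ?_⟩⟩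
        ext z
        simp only [hA, Finset.mem_filter, Finset.mem_singleton]
        exact ⟨fun hz => h.2.2.2 z hz.1 hz.2, fun hz => hz ▸ ⟨h.2.1, h.2.2.1⟩⟩
      obtain ⟨z, p', h', h10, h11⟩ := hI ⟨y, p, by omega, h⟩
      refine ⟨z, p', h', ?_, ?_⟩
      · simpa [hf₃.w 10 rfl, hf₂.w 10 rfl] using h10
      · simpa [hf₃.w 11 rfl, hf₂.w 11 rfl] using h11
  · intro s₁ _ hI
    obtain ⟨x, p, h⟩ := hleaf
    exact hI ⟨x, p, x.2, h⟩
  · have hN := hF.N_le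
    have hL := hF.one_le_L
    calc N * (16 * L + (3 + (3 + 1)) + 2) + 2 ≤ L * (16 * L + (3 + (3 + 1)) + 2) + 2 := by gcongr
      _ ≤ 30 * L ^ 2 := by nlinarith

end

end RAM

namespace RAM

open Coloring

section

variable {n m N : ℕ} {G : Multigraph n m} {q : ℕ} {D : TreeDecomposition G N} {K L W : ℕ}
  {p p₁ p₂ : Program} {T : ℕ} {s s' : State} {Q : State → Prop}

/-! ### Removing a leaf -/

/-- Clear the entries of the number array `1` that are used by `collect`. -/
def clear : Program := forEach (.seq encode (block [.nstore 1 13 4]))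

theorem Tr.clear [NeZero q] (hF : Fits q D K L W) (hB : Base q D s) {x y : Fin N}
    (hx : s.wreg 10 = x) (hy : s.wreg 11 = y) (h4 : s.nreg 4 = 0) :
    Tr W clear (K * (70 * L)) s fun s' => ∀ τ : Fin n → Fin q,
      s'.narr 1 (code (D.bag x ∩ D.bag y) τ) = 0 := by
  refine (Tr.forEach (T := 22 * L + 2) hF hB hx (by decide) (fun A _ na => ∀ τ ∈ A,
    na 1 (code (D.bag x ∩ D.bag y) τ) = 0) (by simp) ?_ ?_).mono ?_ fun _ _ h => h
  · intro A σ hσ hσA s₁ hf₁ hB₁ hx₁ hc₁ hσ₁ hI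
    have hy₁ : s₁.wreg 11 = y := by rw [hf₁.w 11 rfl, hy]
    refine (Tr.encode hF hB₁ hx₁ hy₁ hσ₁ (NeZero.pos q)).seq fun s₂ hf₂ h13 => ?_
    have h4₂ : s₂.nreg 4 = 0 := by rw [hf₂.n 4 rfl, hf₁.n 4 rfl, h4]
    refine Tr.block (by simp [Safes, Instr.Safe]) fun τ hτ => ?_
    simp only [execs, Instr.exec, State.setNArr_narr, h13, h4₂, true_and]
    split_ifs with h
    · rfl
    · rcases Finset.mem_insert.1 hτ with rfl | hτ
      · exact absurd rfl h
      · rw [hf₂.na 1 rfl]; exact hI τ hτ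
  · intro s₁ _ hI τ
    -- Every code on the intersection arises from a coloring of the whole bag, so the pass over the
    -- bag reaches all buckets.
    rw [← hI _ (restrict_mem_cols (D.bag x) τ)]
    congr 1
    exact code_congr fun v hv => (restrict_of_mem _ (Finset.mem_inter.1 hv).1).symm
  · have hL := hF.one_le_L
    exact Nat.mul_le_mul_left _ (by omega)

/-- Sum the table of the node `wreg 10` over the vertices that do not occur in the bag of the node
`wreg 11`. -/
def collect : Program :=
  forEach (.seq encode (block [.wop .mul 26 23 2, .wop .add 26 26 10, .nload 20 0 26,
    .nload 21 1 13, .nop .add 21 21 20, .nstore 1 13 21]))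

/-- Each coloring of the bag of `x` is added to the one bucket addressed by its code on the
intersection, and two colorings share a bucket exactly if they agree there. No pairs of colorings
are compared, which keeps the cost linear in the size of the table. -/
theorem Tr.collect [NeZero q] (hF : Fits q D K L W) (hB : Base q D s) {x y : Fin N}
    (hx : s.wreg 10 = x) (hy : s.wreg 11 = y)
    (h₀ : ∀ τ : Fin n → Fin q, s.narr 1 (code (D.bag x ∩ D.bag y) τ) = 0) :
    Tr W collect (K * (70 * L)) s fun s' => ∀ τ : Fin n → Fin q,
      s'.narr 1 (code (D.bag x ∩ D.bag y) τ) =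
        ∑ ρ ∈ (cols q (D.bag x)).filter (fun ρ => ∀ v ∈ D.bag x ∩ D.bag y, ρ v = τ v),
          s.narr 0 (idx D x ρ) := by
  refine (Tr.forEach (T := 22 * L + 7) hF hB hx (by decide) (fun A _ na => ∀ τ : Fin n → Fin q,
    na 1 (code (D.bag x ∩ D.bag y) τ) =
      ∑ ρ ∈ A.filter (fun ρ => ∀ v ∈ D.bag x ∩ D.bag y, ρ v = τ v), s.narr 0 (idx D x ρ))
    (by simp [h₀]) ?_ ?_).mono ?_ fun _ _ h => h
  · intro A σ hσ hσA s₁ hf₁ hB₁ hx₁ hc₁ hσ₁ hI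
    have hy₁ : s₁.wreg 11 = y := by rw [hf₁.w 11 rfl, hy]
    refine (Tr.encode hF hB₁ hx₁ hy₁ hσ₁ (NeZero.pos q)).seq fun s₂ hf₂ h13 => ?_
    have hi := hF.idx_lt x σ
    have hc := hF.code_mul_lt x σ
    have e23 : s₂.wreg 23 = code (D.bag x) σ := by rw [hf₂.w 23 rfl, hc₁]
    have e10 : s₂.wreg 10 = x := by rw [hf₂.w 10 rfl, hx₁]
    have e2 := (hB₁.of_frame hf₂ (by decide)).w2
    have h0 : s₂.narr 0 = s.narr 0 := by rw [hf₂.na 0 rfl, hf₁.na 0 rfl]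
    have h1 : s₂.narr 1 = s₁.narr 1 := hf₂.na 1 rfl
    refine Tr.block ?_ fun τ => ?_
    · rw [idx] at hi
      simp [Safes, Instr.Safe, Instr.exec, WordOp.eval, e23, e10, e2, hi, hc]
    · simp only [execs, Instr.exec, WordOp.eval, NumOp.eval, State.setWReg_wreg, e23, e10, e2, h13,
        Nat.reduceEqDiff, if_true, if_false, State.setNReg_wreg, State.setNReg_nreg,
        State.setNArr_narr, State.setNReg_narr, State.setWReg_narr, true_and, h0, h1, hI,
        show code (D.bag x) σ * N + x = idx D x σ from rfl]
      rw [Finset.filter_insert]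
      by_cases h : ∀ v ∈ D.bag x ∩ D.bag y, σ v = τ v
      · rw [if_pos (code_congr h).symm, if_pos h, Finset.sum_insert (by simp [hσA]), add_comm]
        have : (fun ρ : Fin n → Fin q => ∀ v ∈ D.bag x ∩ D.bag y, ρ v = σ v) =
            fun ρ => ∀ v ∈ D.bag x ∩ D.bag y, ρ v = τ v := by
          funext ρ
          exact propext (forall₂_congr fun v hv => by rw [h v hv])
        simp only [this]
      · rw [if_neg h, if_neg fun e => h (code_inj e.symm)]
  · exact fun s₁ _ hI => hI
  · have hL := hF.one_le_L
    exact Nat.mul_le_mul_left _ (by omega)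

/-- Remove the leaf `wreg 10` with the neighbor `wreg 11`, which becomes `wreg 10`. -/
def removeLeaf : Program :=
  .seq clear (.seq collect (.seq
    (block [.wstore 5 10 5, .wop .add 37 10 5, .wop .add 10 11 5, .wop .add 11 37 5])
    (mulTable (.seq encode (block [.nload 21 1 13])))))

/-- Registers 10 and 11 are exchanged before the last pass, which then runs over the colorings of
the bag of `y`. The bucket address is symmetric in the two bags, so the same buckets are read that
`collect` filled. -/
theorem Tr.removeLeaf [NeZero q] (hF : Fits q D K L W) (hB : Base q D s) {x y : Fin N}
    (hx : s.wreg 10 = x) (hy : s.wreg 11 = y) (h4 : s.nreg 4 = 0) :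
    Tr W removeLeaf (300 * K * L) s fun s' => s'.wreg 10 = y ∧
      (∀ z : Fin N, s'.warr 5 z = if z = x then 0 else s.warr 5 z) ∧
      ∀ (z : Fin N) (τ : Fin n → Fin q), s'.narr 0 (idx D z τ) = s.narr 0 (idx D z τ) *
        if z = y then ∑ ρ ∈ (cols q (D.bag x)).filter
          (fun ρ => ∀ v ∈ D.bag y ∩ D.bag x, ρ v = τ v), s.narr 0 (idx D x ρ) else 1 := by
  refine ((Tr.clear hF hB hx hy h4).seq (T₂ := K * (70 * L) + (5 + K * ((22 * L + 2) + 6 + 40 * L)))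
    fun s₁ hf₁ h₁ => ?_).mono ?_ fun _ _ h => h
  · have hB₁ := hB.of_frame hf₁ (by decide)
    have hx₁ : s₁.wreg 10 = x := by rw [hf₁.w 10 rfl, hx]
    have hy₁ : s₁.wreg 11 = y := by rw [hf₁.w 11 rfl, hy]
    refine (Tr.collect hF hB₁ hx₁ hy₁ h₁).seq fun s₂ hf₂ h₂ => ?_
    have hB₂ := hB₁.of_frame hf₂ (by decide)
    have hx₂ : s₂.wreg 10 = x := by rw [hf₂.w 10 rfl, hx₁]
    have hy₂ : s₂.wreg 11 = y := by rw [hf₂.w 11 rfl, hy₁]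
    have hNW : N < W := hF.N_le.trans_lt hF.L_lt
    have h₃ : Tr W (RAM.block [.wstore 5 10 5, .wop .add 37 10 5, .wop .add 10 11 5,
        .wop .add 11 37 5]) 5 s₂ fun s₃ => s₃.wreg 10 = y ∧ s₃.wreg 11 = x ∧
        ∀ z : Fin N, s₃.warr 5 z = if z = x then 0 else s₂.warr 5 z := by
      refine Tr.block ?_ ?_
      · simp [Safes, Instr.Safe, Instr.exec, WordOp.eval, hx₂, hy₂, hB₂.w5]
        exact ⟨x.2.trans hNW, y.2.trans hNW, x.2.trans hNW⟩
      · simp [execs, Instr.exec, WordOp.eval, hx₂, hy₂, hB₂.w5, Fin.ext_iff]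
    refine h₃.seq fun s₃ hf₃ hs₃ => ?_
    have hB₃ := hB₂.of_frame hf₃ (by decide)
    refine Tr.mulTable hF hB₃ hs₃.1 (by decide) rfl
      (fun τ => ∑ ρ ∈ (cols q (D.bag x)).filter (fun ρ => ∀ v ∈ D.bag y ∩ D.bag x, ρ v = τ v),
        s.narr 0 (idx D x ρ)) ?_ ?_
    · intro σ hσ s₄ hf₄ hB₄ hy₄ hσ₄
      have hx₄ : s₄.wreg 11 = x := by rw [hf₄.w 11 rfl, hs₃.2.1]
      refine (Tr.encode hF hB₄ hy₄ hx₄ hσ₄ (NeZero.pos q)).seq fun s₅ hf₅ h13 => ?_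
      refine Tr.block (by simp [Safes, Instr.Safe]) ?_
      have e : s₅.narr 1 = s₂.narr 1 := by rw [hf₅.na 1 rfl, hf₄.na 1 rfl, hf₃.na 1 rfl]
      simp only [execs, Instr.exec, State.setNReg_nreg, if_true, h13, e,
        Finset.inter_comm (D.bag y), h₂, hf₁.na 0 rfl]
    · intro s₄ hf₄ hs₄
      refine ⟨?_, fun z => ?_, fun z τ => ?_⟩
      · rw [hf₄.w 10 rfl, hs₃.1]
      · rw [hf₄.wa 5 rfl, hs₃.2.2, hf₂.wa 5 rfl, hf₁.wa 5 rfl]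
      · rw [hs₄, hf₃.na 0 rfl, hf₂.na 0 rfl, hf₁.na 0 rfl]
        congr 1
        split_ifs with hz
        · refine Finset.sum_congr (Finset.filter_congr fun ρ _ => ?_) fun _ _ => rfl
          exact forall₂_congr fun v hv => by rw [restrict_of_mem _ (Finset.mem_inter.1 hv).1]
        · rfl
  · have hL := hF.one_le_L
    have hK := hF.one_le_K
    have h₂ : K ≤ K * L := Nat.le_mul_of_pos_right _ hL
    nlinarith

/-! ### Correctness of leaf elimination -/

/-- The nodes in `S` still form a tree, and so do those among them that contain a given vertex. -/
structure Pruned (D : TreeDecomposition G N) (S : Finset (Fin N)) : Prop where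
  cut : D.tree.CutConnected S
  bags : ∀ v, D.tree.CutConnected {x | x ∈ S ∧ v ∈ D.bag x}

theorem pruned_univ (D : TreeDecomposition G N) : Pruned D Finset.univ := by
  refine ⟨?_, fun v => ?_⟩
  · refine SimpleGraph.Preconnected.cutConnected ?_
    have := D.isTree.connected.preconnected
    intro u v
    obtain ⟨p⟩ := this u v
    exact ⟨p.induce _ (by simp)⟩
  · simpa using (D.subtree v).preconnected.cutConnected

theorem Pruned.erase {S : Finset (Fin N)} (h : Pruned D S) {x y : Fin N}
    (hl : D.tree.IsLeafAt S x y) : Pruned D (S.erase x) := by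
  refine ⟨?_, fun v => ?_⟩
  · rw [Finset.coe_erase]
    exact hl.cutConnected_diff subset_rfl h.cut
  · convert hl.cutConnected_diff (fun z hz => hz.1) (h.bags v) using 1
    ext z
    simp only [Finset.mem_erase, Set.mem_ofPred_eq, Set.mem_sdiff, Set.mem_singleton_iff]
    tauto

/-- The sum over all colorings of the vertices in the bags of `S` of the product of the tables. -/
noncomputable def total (D : TreeDecomposition G N) (q : ℕ) [NeZero q] (S : Finset (Fin N))
    (f : ℕ → ℂ) : ℂ :=
  ∑ σ ∈ cols q (S.biUnion D.bag), ∏ x ∈ S, f (idx D x σ)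

/-- This is `sum_eliminate` with `U` the union of the remaining bags and `X` the bag of the leaf. By
connectedness `U ∩ X` is the intersection of the bags of `y` and `x`, so the inner sum is the factor
that the table of `y` receives. -/
theorem Pruned.total_erase [NeZero q] {S : Finset (Fin N)} (h : Pruned D S) {x y : Fin N}
    (hl : D.tree.IsLeafAt S x y) {f g : ℕ → ℂ}
    (hg : ∀ (z : Fin N) (τ : Fin n → Fin q), g (idx D z τ) = f (idx D z τ) *
        if z = y then ∑ ρ ∈ (cols q (D.bag x)).filter
          (fun ρ => ∀ v ∈ D.bag y ∩ D.bag x, ρ v = τ v), f (idx D x ρ) else 1) :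
    total D q (S.erase x) g = total D q S f := by
  have hx : x ∈ S := hl.1
  have hyx : y ≠ x := hl.2.2.1.ne'
  have hy : y ∈ S.erase x := Finset.mem_erase.2 ⟨hyx, hl.2.1⟩
  have hS : S.biUnion D.bag = (S.erase x).biUnion D.bag ∪ D.bag x := by
    conv_lhs => rw [← Finset.insert_erase hx]
    rw [Finset.biUnion_insert, Finset.union_comm]
  have hinter : (S.erase x).biUnion D.bag ∩ D.bag x = D.bag y ∩ D.bag x := by
    ext v
    simp only [Finset.mem_inter, Finset.mem_biUnion]
    refine and_congr_left fun hv => ⟨?_, fun h' => ⟨y, hy, h'⟩⟩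
    rintro ⟨z, hz, hvz⟩
    rw [Finset.mem_erase] at hz
    exact (hl.mem_of_cutConnected (fun z hz => hz.1) (h.bags v) (y := z) ⟨hx, hv⟩ ⟨hz.2, hvz⟩
      hz.1).2
  have hH : ∀ σ τ : Fin n → Fin q, (∀ v ∈ (S.erase x).biUnion D.bag, σ v = τ v) →
      ∏ z ∈ S.erase x, f (idx D z σ) = ∏ z ∈ S.erase x, f (idx D z τ) := fun σ τ h =>
    Finset.prod_congr rfl fun z hz => by
      rw [idx_congr fun v hv => h v (Finset.mem_biUnion.2 ⟨z, hz, hv⟩)]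
  have hF : ∀ σ τ : Fin n → Fin q, (∀ v ∈ D.bag x, σ v = τ v) →
      f (idx D x σ) = f (idx D x τ) := fun σ τ h => by rw [idx_congr h]
  have key := sum_eliminate hH hF
  rw [hinter, ← hS] at key
  rw [total, total]
  refine Eq.trans ?_ (key.symm.trans (Finset.sum_congr rfl fun σ _ => Finset.prod_erase_mul _ _ hx))
  refine Finset.sum_congr rfl fun σ _ => ?_
  simp_rw [hg, Finset.prod_mul_distrib, Finset.prod_ite_eq' (S.erase x) y, if_pos hy]

/-- Remove leaves until only the node `wreg 10` is left. -/
def prune : Program :=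
  .seq (block [.wop .sub 41 2 3, .wconst 10 0]) (forLoop 40 41 (.seq findLeaf removeLeaf))

theorem Tr.prune [NeZero q] (hF : Fits q D K L W) (hB : Base q D s) (h4 : s.nreg 4 = 0)
    (h5 : ∀ x : Fin N, s.warr 5 x = 1) :
    Tr W prune (340 * K * L ^ 3) s fun s' => ∃ x : Fin N, s'.wreg 10 = x ∧
      total D q {x} (s'.narr 0) = total D q Finset.univ (s.narr 0) := by
  have hN : 0 < N := (D.isTree.connected.nonempty).some.pos
  have hNW : N < W := hF.N_le.trans_lt hF.L_lt
  have h₁ : Tr W (RAM.block [.wop .sub 41 2 3, .wconst 10 0]) 3 s fun s₁ =>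
      s₁.wreg 41 = N - 1 ∧ s₁.wreg 10 = 0 := by
    refine Tr.block ?_ ?_
    · simp [Safes, Instr.Safe, WordOp.eval, hB.w2, hB.w3]
      omega
    · simp [execs, Instr.exec, WordOp.eval, hB.w2, hB.w3]
  refine (h₁.seq (T₂ := (N - 1) * (30 * L ^ 2 + 300 * K * L + 2) + 2) fun s₁ hf₁ hs₁ => ?_).mono ?_
    fun _ _ h => h
  · have hB₁ := hB.of_frame hf₁ (by decide)
    -- After `j` rounds `N - j` nodes are alive and register 10 holds one of them. Its initial
    -- value, node `0`, is the final answer when `N = 1` and no round takes place.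
    refine Tr.forLoop (fun j s' => ∃ S : Finset (Fin N), S.card + j = N ∧ Alive s' S ∧ Pruned D S ∧
      (∃ x ∈ S, s'.wreg 10 = (x : Fin N)) ∧
      total D q S (s'.narr 0) = total D q Finset.univ (s.narr 0)) hs₁.1 hB₁.w3 (by decide)
      (by decide) ⟨rfl, rfl, rfl⟩ ?_ ?_ ?_
    · refine ⟨Finset.univ, by simp, fun x => ?_, pruned_univ D, ⟨⟨0, hN⟩, by simp [hs₁.2]⟩, ?_⟩
      · simp [hf₁.wa 5 rfl, h5]
      · simp [hf₁.na 0 rfl]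
    · rintro j hj s₂ hf₂ - ⟨S, hcard, hS, hP, -, htot⟩
      have hB₂ := hB₁.of_frame hf₂ (by decide)
      have hnt : (S : Set (Fin N)).Nontrivial := by
        refine Finset.one_lt_card_iff_nontrivial.1 ?_
        omega
      refine (Tr.findLeaf hF hB₂ hS (D.isTree.isAcyclic.exists_isLeafAt hP.cut hnt)).seq
        fun s₃ hf₃ hs₃ => ?_
      obtain ⟨x, y, hl, h10, h11⟩ := hs₃
      have hB₃ := hB₂.of_frame hf₃ (by decide)
      have h4₃ : s₃.nreg 4 = 0 := by rw [hf₃.n 4 rfl, hf₂.n 4 rfl, hf₁.n 4 rfl, h4]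
      refine (Tr.removeLeaf hF hB₃ h10 h11 h4₃).mono le_rfl fun s₄ hf₄ hs₄ => ?_
      obtain ⟨hy, h5', hna⟩ := hs₄
      have hx : x ∈ S := hl.1
      refine ⟨S.erase x, ?_, fun z => ?_, hP.erase hl, ⟨y, ?_, ?_⟩, ?_⟩
      · rw [Finset.card_erase_of_mem hx]; have := Finset.card_pos.2 ⟨x, hx⟩; omega
      · rw [State.setWReg_warr, h5', hf₃.wa 5 rfl, hS z]
        by_cases hz : z = x <;> simp [hz]
      · exact Finset.mem_erase.2 ⟨hl.2.2.1.ne', hl.2.1⟩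
      · simpa using hy
      · rw [State.setWReg_narr, ← htot, ← hf₃.na 0 rfl]
        exact hP.total_erase hl hna
    · rintro s₂ - ⟨S, hcard, -, -, ⟨x, hx, h10⟩, htot⟩
      obtain ⟨z, rfl⟩ := Finset.card_eq_one.1 (show S.card = 1 by omega)
      obtain rfl := Finset.mem_singleton.1 hx
      exact ⟨x, h10, htot⟩
  · have hL := hF.one_le_L
    have hK := hF.one_le_K
    have h₁ : 1 ≤ K * L := Nat.mul_pos hK hL
    have h₂ : L ^ 2 ≤ K * L * L := by
      rw [pow_two, mul_assoc]; exact Nat.le_mul_of_pos_left _ hK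
    have h₃ : K * L ≤ K * L * L := Nat.le_mul_of_pos_right _ hL
    have h₄ : K * L * L ≤ K * L * L * L := Nat.le_mul_of_pos_right _ hL
    calc 3 + ((N - 1) * (30 * L ^ 2 + 300 * K * L + 2) + 2)
        ≤ 3 + (L * (30 * (K * L * L) + 300 * (K * L * L) + 2 * (K * L * L)) + 2) := by
          refine Nat.add_le_add_left (Nat.add_le_add_right (Nat.mul_le_mul
            ((Nat.sub_le _ _).trans hF.N_le) ?_) _) _
          rw [mul_assoc 300]
          omega
      _ ≤ 340 * K * L ^ 3 := by nlinarith

/-- `nreg 2` becomes the sum of the table of the node `wreg 10`. -/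
def sumTable : Program :=
  .seq (block [.ncast 2 5]) (forEach (block [.wop .mul 26 23 2, .wop .add 26 26 10, .nload 20 0 26,
    .nop .add 2 2 20]))

theorem Tr.sumTable [NeZero q] (hF : Fits q D K L W) (hB : Base q D s) {x : Fin N}
    (hx : s.wreg 10 = x) :
    Tr W sumTable (50 * K * L) s fun s' =>
      s'.nreg 2 = ∑ σ ∈ cols q (D.bag x), s.narr 0 (idx D x σ) := by
  have h₁ : Tr W (RAM.block [.ncast 2 5]) 2 s fun s₁ => s₁.nreg 2 = 0 :=
    Tr.block (by simp [Safes, Instr.Safe]) (by simp [execs, Instr.exec, hB.w5])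
  refine (h₁.seq (T₂ := K * (5 + 40 * L)) fun s₁ hf₁ hs₁ => ?_).mono ?_ fun _ _ h => h
  · have hB₁ := hB.of_frame hf₁ (by decide)
    refine Tr.forEach hF hB₁ (x := x) (by rw [hf₁.w 10 rfl, hx]) (by decide)
      (fun A nr _ => nr 2 = ∑ σ ∈ A, s.narr 0 (idx D x σ)) (by simpa using hs₁) ?_ fun _ _ h => h
    intro A σ hσ hσA s₂ hf₂ hB₂ hx₂ hc₂ hσ₂ hI
    have hi := hF.idx_lt x σ
    have hc := hF.code_mul_lt x σ
    have h0 : s₂.narr 0 = s.narr 0 := by rw [hf₂.na 0 rfl, hf₁.na 0 rfl]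
    refine Tr.block ?_ ?_
    · rw [idx] at hi
      simp [Safes, Instr.Safe, Instr.exec, WordOp.eval, hc₂, hx₂, hB₂.w2, hi, hc]
    · simp [execs, Instr.exec, WordOp.eval, NumOp.eval, hc₂, hx₂, hB₂.w2, h0, hI,
        Finset.sum_insert hσA, idx, add_comm]
  · have hL := hF.one_le_L
    have hK := hF.one_le_K
    have h₂ : K ≤ K * L := Nat.le_mul_of_pos_right _ hL
    nlinarith

/-! ### The partition function -/

/-- `nreg 2` becomes the partition function with the weights `nreg 10` and `nreg 11`. -/
def pottsProg : Program := .seq initTables (.seq edges (.seq prune sumTable))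

theorem Tr.pottsProg [NeZero q] (hF : Fits q D K L W) (hB : Base q D s) {w₁ w₂ : ℂ}
    (h3 : s.nreg 3 = 1) (h4 : s.nreg 4 = 0) (h10 : s.nreg 10 = w₁) (h11 : s.nreg 11 = w₂) :
    Tr W pottsProg (540 * K * L ^ 3) s fun s' => s'.nreg 2 = G.potts q w₁ w₂ := by
  refine ((Tr.initTables hF hB h3).seq (T₂ := 100 * K * L ^ 2 + (340 * K * L ^ 3 + 50 * K * L))
    fun s₁ hf₁ hs₁ => ?_).mono ?_ fun _ _ h => h
  · have hB₁ := hB.of_frame hf₁ (by decide)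
    refine (Tr.edges hF hB₁ ((hf₁.n 4 rfl).trans h4) ((hf₁.n 10 rfl).trans h10)
      ((hf₁.n 11 rfl).trans h11) fun x τ => (hs₁ x).2 τ).seq fun s₂ hf₂ hs₂ => ?_
    have hB₂ := hB₁.of_frame hf₂ (by decide)
    refine (Tr.prune hF hB₂ (by rw [hf₂.n 4 rfl, hf₁.n 4 rfl, h4])
      fun x => by rw [hf₂.wa 5 rfl, (hs₁ x).1]).seq fun s₃ hf₃ hs₃ => ?_
    obtain ⟨x, hx, htot⟩ := hs₃
    have hB₃ := hB₂.of_frame hf₃ (by decide)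
    refine (Tr.sumTable hF hB₃ hx).mono le_rfl fun s₄ _ hs₄ => ?_
    rw [hs₄, Multigraph.potts]
    simp only [total, Finset.singleton_biUnion, Finset.prod_singleton] at htot
    rw [htot]
    -- The bags cover all vertices, so the initial total ranges over all colorings and equals the
    -- partition function.
    have hU : (Finset.univ : Finset (Fin N)).biUnion D.bag = Finset.univ := by
      ext v
      simpa using D.vertex_covered v
    rw [hU, Finset.sum_congr rfl fun σ _ => hs₂ σ]
    refine Finset.sum_congr (Finset.ext fun σ => ?_) fun _ _ => rfl
    simp [mem_cols]
  · have hL := hF.one_le_L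
    have hK := hF.one_le_K
    have h₁ : K * L ≤ K * L * L := Nat.le_mul_of_pos_right _ hL
    have h₂ : K * L * L ≤ K * L * L * L := Nat.le_mul_of_pos_right _ hL
    nlinarith

end

end RAM

namespace RAM

/-! ## The program for the Tutte polynomial -/

section

variable {n m N : ℕ} {G : Multigraph n m} {q : ℕ} {D : TreeDecomposition G N} {K L W : ℕ}
  {s : State}

theorem input_wordsBelow (G : Multigraph n m) (D : TreeDecomposition G N) (a b : ℂ) (hn : n < W)
    (hm : m < W) (hN : N < W) (h1 : 1 < W) : (input G D a b).WordsBelow W := by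
  refine ⟨fun i => ?_, fun r i => ?_⟩
  · simp only [input]
    split <;> omega
  · simp only [input]
    split <;> beta_reduce
    · split_ifs with h
      · exact (Fin.isLt _).trans hn
      · omega
    · split_ifs with h
      · exact (Fin.isLt _).trans hn
      · omega
    · split_ifs <;> omega
    · split_ifs <;> omega
    · omega

/-- Set up the constants and the weights `b` and `1`. -/
def prologue (q : ℕ) : Program :=
  block [.wconst 3 1, .wconst 4 q, .wconst 5 0, .ncast 3 3, .ncast 4 5, .nop .add 10 1 4,
    .nop .add 11 3 4]

theorem Tr.prologue (G : Multigraph n m) (D : TreeDecomposition G N) (a b : ℂ) (hq : q < W)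
    (h1 : 1 < W) :
    Tr W (prologue q) 8 (input G D a b) fun s => Base q D s ∧ s.nreg 0 = a ∧ s.nreg 1 = b ∧
      s.nreg 3 = 1 ∧ s.nreg 4 = 0 ∧ s.nreg 10 = b ∧ s.nreg 11 = 1 := by
  refine Tr.block ?_ ⟨?_, ?_⟩
  · simp [Safes, Instr.Safe, hq, h1]
    omega
  · constructor
    · simp [execs, Instr.exec, input]
    · simp [execs, Instr.exec, input]
    · simp [execs, Instr.exec, input]
    · simp [execs, Instr.exec, input]
    · simp [execs, Instr.exec, input]
    · simp [execs, Instr.exec, input]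
    · simp [execs, Instr.exec, input]
    · simp [execs, Instr.exec, input]
    · intro x y
      simp only [execs, Instr.exec, input, State.setWReg_warr, State.setNReg_warr]
      split_ifs with h
      · obtain ⟨x', y', he, h⟩ := h
        obtain ⟨hx, hy⟩ := mul_add_inj y.2 y'.2 he
        rw [Fin.ext hx, Fin.ext hy]
        simpa using h
      · simp only [false_iff]
        exact fun h' => h ⟨x, y, rfl, h'⟩
    · intro x v
      simp only [execs, Instr.exec, input, State.setWReg_warr, State.setNReg_warr]
      split_ifs with h
      · obtain ⟨x', v', he, h⟩ := h
        obtain ⟨hx, hv⟩ := mul_add_inj v.2 v'.2 he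
        rw [Fin.ext hx, Fin.ext hv]
        simpa using h
      · simp only [false_iff]
        exact fun h' => h ⟨x, v, rfl, h'⟩
    · intro x y
      simp only [execs, Instr.exec, input, State.setWReg_warr, State.setNReg_warr]
      split_ifs <;> simp
    · intro x v
      simp only [execs, Instr.exec, input, State.setWReg_warr, State.setNReg_warr]
      split_ifs <;> simp
  · simp [execs, Instr.exec, input, NumOp.eval]

/-- Divide `nreg 5` by the `n`-th power of `nreg 6`. -/
def dividePow : Program := forLoop 20 0 (block [.nop .div 5 5 6])

theorem Tr.dividePow (hB : Base q D s) :
    Tr W dividePow (n * (2 + 2) + 2) s fun s' => s'.nreg 5 = s.nreg 5 / s.nreg 6 ^ n := by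
  refine Tr.forLoop (fun j s' => s'.nreg 5 = s.nreg 5 / s.nreg 6 ^ j) hB.w0 hB.w3 (by decide)
    (by decide) ⟨rfl, rfl, rfl⟩ (by simp) (fun j hj s₁ hf₁ hi hI => ?_) fun s₁ _ hI => hI
  refine Tr.block (by simp [Safes, Instr.Safe]) ?_
  simp [execs, Instr.exec, NumOp.eval, hI, hf₁.n 6 rfl, div_div, pow_succ]

/-- If `nreg 2` is the `k`-th power of `nreg 8`, where `k ≤ n`, divide `nreg 5` by the `k`-th power
of `nreg 7`. -/
def divideLog : Program :=
  forLoop 20 0 (.seq (block [.nop .sub 9 2 3])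
    (.ite (.nzero 9) .skip (block [.nop .div 2 2 8, .nop .div 5 5 7])))

/-- The exponent is never computed as a word: `q ^ k` is divided by `q` until it equals 1, which for
`q > 1` happens exactly after `k` rounds. Since `k ≤ n`, `n` rounds suffice, and the surplus ones
change neither quotient. -/
theorem Tr.divideLog (hB : Base q D s) (hq : 1 < q) (h3 : s.nreg 3 = 1) (h8 : s.nreg 8 = q) {k : ℕ}
    (hk : k ≤ n) (h2 : s.nreg 2 = (q : ℂ) ^ k) :
    Tr W divideLog (n * (2 + (3 + 1) + 2) + 2) s fun s' =>
      s'.nreg 5 = s.nreg 5 / s.nreg 7 ^ k := by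
  have hq0 : (q : ℂ) ≠ 0 := Nat.cast_ne_zero.2 (by omega)
  refine Tr.forLoop (fun j s' => s'.nreg 2 = (q : ℂ) ^ (k - j) ∧
      s'.nreg 5 = s.nreg 5 / s.nreg 7 ^ (min j k)) hB.w0 hB.w3 (by decide)
    (by decide) ⟨rfl, rfl, rfl⟩ (by simp [h2]) (fun j hj s₁ hf₁ hi hI => ?_) fun s₁ _ hI => ?_
  · have h₂ : Tr W (RAM.block [.nop .sub 9 2 3]) 2 s₁ fun s₂ =>
        s₂.nreg 9 = (q : ℂ) ^ (k - j) - 1 :=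
      Tr.block (by simp [Safes, Instr.Safe])
        (by simp [execs, Instr.exec, NumOp.eval, hI, hf₁.n 3 rfl, h3])
    refine h₂.seq fun s₂ hf₂ h9 => ?_
    have h2₂ : s₂.nreg 2 = (q : ℂ) ^ (k - j) := by rw [hf₂.n 2 rfl, hI.1]
    have h5₂ : s₂.nreg 5 = s.nreg 5 / s.nreg 7 ^ (min j k) := by rw [hf₂.n 5 rfl, hI.2]
    have hiff : (Test.nzero 9).holds s₂ ↔ k ≤ j := by
      rw [Test.holds, h9, sub_eq_zero]
      norm_cast
      rw [Nat.pow_eq_one]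
      omega
    refine Tr.ite (fun hb => Tr.skip_of_pos ?_ (by decide))
      (fun hb => Tr.block (by simp [Safes, Instr.Safe]) ?_)
    · have hkj := hiff.1 hb
      rw [State.setWReg_nreg, h2₂, h5₂, min_eq_right hkj, min_eq_right (by omega),
        Nat.sub_eq_zero_of_le hkj, Nat.sub_eq_zero_of_le (by omega)]
      exact ⟨rfl, rfl⟩
    · have hkj := mt hiff.2 hb
      have e₁ : k - j = k - (j + 1) + 1 := by omega
      have e₂ : min (j + 1) k = min j k + 1 := by omega
      have h8₂ : s₂.nreg 8 = q := by rw [hf₂.n 8 rfl, hf₁.n 8 rfl, h8]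
      have h7₂ : s₂.nreg 7 = s.nreg 7 := by rw [hf₂.n 7 rfl, hf₁.n 7 rfl]
      rw [e₁, pow_succ] at h2₂
      simp only [execs, Instr.exec, NumOp.eval, State.setNReg_nreg, State.setWReg_nreg,
        Nat.reduceEqDiff, if_true, if_false, h2₂, h5₂, h8₂, h7₂, e₂, pow_succ, div_div]
      exact ⟨mul_div_cancel_right₀ _ hq0, trivial⟩
  · rw [hI.2, min_eq_right hk]

/-- Compute the Tutte polynomial from the partition functions with the weights `b, 1` and `1, 0`. -/
def tutteProg (q : ℕ) : Program :=
  .seq (prologue q) (.seq pottsProg (.seq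
    (block [.nop .add 5 2 4, .nop .add 10 3 4, .nop .add 11 4 4]) (.seq pottsProg (.seq
    (block [.nop .sub 6 1 3, .nop .sub 7 0 3, .ncast 8 4]) (.seq dividePow (.seq divideLog
    (block [.nop .add 0 5 4])))))))

theorem Tr.tutteProg (hF : Fits q D K L W) (hq : 1 < q) {a b : ℂ}
    (hab : (a, b) ∈ hyperbola (q : ℂ)) :
    Tr W (tutteProg q) (1200 * K * L ^ 3) (input G D a b) fun s => s.nreg 0 = G.tutte a b := by
  have : NeZero q := ⟨by omega⟩
  -- Two Potts computations take `1080 * K * L ^ 3` steps; the other `12 * n + 22` steps fit into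
  -- the remaining `120 * K * L ^ 3`.
  refine ((Tr.prologue G D a b hF.q_lt hF.one_lt).seq (T₂ := 540 * K * L ^ 3 + (4 +
    (540 * K * L ^ 3 + (4 + ((n * (2 + 2) + 2) + ((n * (2 + (3 + 1) + 2) + 2) + 2))))))
    fun s₁ _ hs₁ => ?_).mono ?_ fun _ _ h => h
  · obtain ⟨hB₁, h0₁, h1₁, h3₁, h4₁, h10₁, h11₁⟩ := hs₁
    refine (Tr.pottsProg hF hB₁ h3₁ h4₁ h10₁ h11₁).seq fun s₂ hf₂ h2₂ => ?_
    have hB₂ := hB₁.of_frame hf₂ (by decide)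
    have h3₂ := (hf₂.n 3 rfl).trans h3₁
    have h4₂ := (hf₂.n 4 rfl).trans h4₁
    have h₃ : Tr W (RAM.block [.nop .add 5 2 4, .nop .add 10 3 4, .nop .add 11 4 4]) 4 s₂
        fun s₃ => s₃.nreg 5 = G.potts q b 1 ∧ s₃.nreg 10 = 1 ∧ s₃.nreg 11 = 0 :=
      Tr.block (by simp [Safes, Instr.Safe])
        (by simp [execs, Instr.exec, NumOp.eval, h2₂, h3₂, h4₂])
    refine h₃.seq fun s₃ hf₃ hs₃ => ?_
    obtain ⟨h5₃, h10₃, h11₃⟩ := hs₃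
    have hB₃ := hB₂.of_frame hf₃ (by decide)
    have h3₃ := (hf₃.n 3 rfl).trans h3₂
    have h4₃ := (hf₃.n 4 rfl).trans h4₂
    refine (Tr.pottsProg hF hB₃ h3₃ h4₃ h10₃ h11₃).seq fun s₄ hf₄ h2₄ => ?_
    have hB₄ := hB₃.of_frame hf₄ (by decide)
    have h0₄ : s₄.nreg 0 = a := by rw [hf₄.n 0 rfl, hf₃.n 0 rfl, hf₂.n 0 rfl, h0₁]
    have h1₄ : s₄.nreg 1 = b := by rw [hf₄.n 1 rfl, hf₃.n 1 rfl, hf₂.n 1 rfl, h1₁]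
    have h3₄ := (hf₄.n 3 rfl).trans h3₃
    have h₅ : Tr W (RAM.block [.nop .sub 6 1 3, .nop .sub 7 0 3, .ncast 8 4]) 4 s₄
        fun s₅ => s₅.nreg 6 = b - 1 ∧ s₅.nreg 7 = a - 1 ∧ s₅.nreg 8 = q :=
      Tr.block (by simp [Safes, Instr.Safe])
        (by simp [execs, Instr.exec, NumOp.eval, h0₄, h1₄, h3₄, hB₄.w4])
    refine h₅.seq fun s₅ hf₅ hs₅ => ?_
    obtain ⟨h6₅, h7₅, h8₅⟩ := hs₅
    have hB₅ := hB₄.of_frame hf₅ (by decide)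
    refine (Tr.dividePow hB₅).seq fun s₆ hf₆ h5₆ => ?_
    have hB₆ := hB₅.of_frame hf₆ (by decide)
    refine (Tr.divideLog hB₆ hq (by rw [hf₆.n 3 rfl, hf₅.n 3 rfl, h3₄])
      (by rw [hf₆.n 8 rfl, h8₅]) (G.numComponents_le Finset.univ)
      (by rw [hf₆.n 2 rfl, hf₅.n 2 rfl, h2₄, G.potts_one_zero])).seq fun s₇ hf₇ h5₇ => ?_
    have h4₇ : s₇.nreg 4 = 0 := by
      rw [hf₇.n 4 rfl, hf₆.n 4 rfl, hf₅.n 4 rfl, hf₄.n 4 rfl, h4₃]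
    refine Tr.block (by simp [Safes, Instr.Safe]) ?_
    rw [← G.tutte_mul q (by omega) hab]
    simp [execs, Instr.exec, NumOp.eval, h4₇, h5₇, h5₆, hf₆.n 7 rfl, h7₅, h6₅, hf₅.n 5 rfl,
      hf₄.n 5 rfl, h5₃]
  · have hn := hF.n_le
    have h : L ≤ K * L ^ 3 :=
      (Nat.le_self_pow (by norm_num) L).trans (Nat.le_mul_of_pos_left _ hF.one_le_K)
    have hL := hF.one_le_L
    simp only [mul_assoc]
    omega

end

end RAM

/-! ### Bounds in terms of the width -/

theorem TreeDecomposition.card_bag_le {n m N : ℕ} {G : Multigraph n m} (D : TreeDecomposition G N)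
    (x : Fin N) : (D.bag x).card ≤ D.width + 1 := by
  have := Finset.le_sup (f := fun x => (D.bag x).card) (Finset.mem_univ x)
  simp only [TreeDecomposition.width] at this ⊢
  omega

/-- The time bound itself serves as word bound; it exceeds all addresses into the tables and
matrices. A tree is nonempty, so `n + m + N` is positive even for the graph without vertices. -/
theorem TreeDecomposition.fits {n m N : ℕ} {G : Multigraph n m} (D : TreeDecomposition G N) {q : ℕ}
    (hq : 0 < q) : RAM.Fits q D (q ^ (D.width + 1)) (n + m + N)
      (1200 * q ^ (D.width + 1) * (n + m + N) ^ 3) := by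
  have hN : 0 < N := (D.isTree.connected.nonempty).some.pos
  have hK : 1 ≤ q ^ (D.width + 1) := Nat.pow_pos hq
  have hqK : q ≤ q ^ (D.width + 1) := Nat.le_self_pow (by omega) q
  have hbag : ∀ x, q ^ (D.bag x).card ≤ q ^ (D.width + 1) := fun x =>
    Nat.pow_le_pow_right hq (D.card_bag_le x)
  have hnL : n ≤ n + m + N := by omega
  have hNL : N ≤ n + m + N := by omega
  have hmL : m ≤ n + m + N := by omega
  have hL : 1 ≤ n + m + N := by omega
  generalize q ^ (D.width + 1) = K at *
  generalize n + m + N = L at *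
  have hKL : K * L ≤ K * L ^ 3 := Nat.mul_le_mul_left _ (Nat.le_self_pow (by norm_num) L)
  have hLL : L * L ≤ K * L ^ 3 := by
    rw [← pow_two]
    exact (Nat.pow_le_pow_right hL (by norm_num)).trans (Nat.le_mul_of_pos_left _ hK)
  have hKL' : K ≤ K * L := Nat.le_mul_of_pos_right _ hL
  have hLL' : L ≤ L * L := Nat.le_mul_of_pos_right _ hL
  rw [mul_assoc]
  refine ⟨hnL, hmL, hNL, hL, hK, hbag, fun x => ?_, ?_, ?_, by omega, by omega, by omega⟩
  · have := Nat.mul_le_mul (hbag x) hNL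
    omega
  · have := Nat.mul_le_mul hNL hnL
    omega
  · have := Nat.mul_le_mul hNL hNL
    omega

theorem mainTheorem8 (q : ℕ) (hq : 3 ≤ q) :
    ∃ (p : RAM.Program) (C c : ℕ),
      ∀ a b : ℂ, (a, b) ∈ hyperbola (q : ℂ) →
        ∀ (n m N : ℕ) (G : Multigraph n m) (D : TreeDecomposition G N),
          RAM.ComputesTutteWithin p G D a b (C * q ^ D.width * (n + m + N) ^ c) := by
  -- Bags have up to `width + 1` vertices; the extra factor `q` is absorbed into the constant.
  refine ⟨RAM.tutteProg q, 1200 * q, 3, fun a b hab n m N G D => ?_⟩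
  have hF := D.fits (q := q) (by omega)
  have e : 1200 * q * q ^ D.width * (n + m + N) ^ 3 =
      1200 * q ^ (D.width + 1) * (n + m + N) ^ 3 := by ring
  rw [e]
  obtain ⟨t, s, hex, ht, -, hs⟩ := RAM.Tr.tutteProg hF (by omega) hab
    (RAM.input_wordsBelow G D a b (hF.n_le.trans_lt hF.L_lt) (hF.m_le.trans_lt hF.L_lt)
      (hF.N_le.trans_lt hF.L_lt) hF.one_lt)
  exact ⟨t, s, hex, ht, hs⟩
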